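/- Let $\mathbb{G}$ be a Carnot group of step $s$, that is, a connected and simply connected (real, finite-dimensional) Lie group whose Lie algebra has a stratification $\mathfrak{g}=\mathfrak{g}_1\oplus\cdots\oplus\mathfrak{g}_s$ with $[\mathfrak{g}_1,\mathfrak{g}_i]=\mathfrak{g}_{i+1}$ for $i=1,\dots,s-1$, $\mathfrak{g}_s\neq\{0\}$ and $[\mathfrak{g}_1,\mathfrak{g}_s]=\{0\}$. Fix a scalar product on $\mathfrak{g}_1$ and let $\mathbb{S}(\mathfrak{g}_1)$ be its unit sphere. For $\nu\in\mathfrak{g}_1\setminus\{0\}$ let $\nu^\perp$ be the orthogonal space to $\nu$ within $\mathfrak{g}_1$, and let $S_\nu\subseteq\mathbb{G}$ be the semigroup generated by $\exp(\nu^\perp+\mathbb{R}^+\nu)$, i.e. $S_\nu=\bigcup_{k=1}^\infty A^k$ with $A=\{\exp(Z+t\nu): Z\in\nu^\perp,\ t\ge 0\}$. Then for every $\nu\in\mathbb{S}(\mathfrak{g}_1)$ there exists an open neighborhood $U$ of $\nu$ in $\mathbb{S}(\mathfrak{g}_1)$ such that $$\bigcap_{\mu\in U}S_\mu$$ has non-empty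 interior. Moreover, if $\nu\in\mathbb{S}(\mathfrak{g}_1)$ and $X\in\mathfrak{g}_1$ are such that $\exp(X)\in\operatorname{int}(S_\nu)$, then one can choose $U$ in such a way that $\exp(X)\in\operatorname{int}\bigl(\bigcap_{\mu\in U}S_\mu\bigr)$. -/

import Mathlib

open Set
open scoped Manifold ContDiff Topology

/-- On a smooth real Lie group the regularity that Mathlib asks for in order to build
the Lie algebra is available. -/
instance instLEInftyMinSmoothnessRealThree : ENat.LEInfty (minSmoothness ℝ 3) := by
  constructor
  rw [minSmoothness_of_isRCLikeNormedField]
  exact WithTop.coe_le_coe.mpr (le_top : (3 : ℕ∞) ≤ ⊤)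

section LieExp

variable {E : Type*} [NormedAddCommGroup E] [NormedSpace ℝ E]
  {G : Type*} [TopologicalSpace G] [ChartedSpace E G] [Group G]

/-- `γ` is the one-parameter subgroup of the Lie group `G` with initial velocity `X ∈ Lie(G)`, that
is, the integral curve, defined on all of `ℝ` and starting at the identity, of the left-invariant
vector field determined by `X`. -/
def IsOneParameterSubgroup (X : GroupLieAlgebra 𝓘(ℝ, E) G) (γ : ℝ → G) : Prop :=
  γ 0 = 1 ∧ IsMIntegralCurve (I := 𝓘(ℝ, E)) γ (mulInvariantVectorField X)

/-- Left translations map integral curves of a left-invariant vector field to integral curves. -/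
theorem IsMIntegralCurveOn.left_translate [LieGroup 𝓘(ℝ, E) ∞ G]
    {X : GroupLieAlgebra 𝓘(ℝ, E) G} {γ : ℝ → G} {s : Set ℝ}
    (h : IsMIntegralCurveOn (I := 𝓘(ℝ, E)) γ (mulInvariantVectorField X) s) (g : G) :
    IsMIntegralCurveOn (I := 𝓘(ℝ, E)) (fun t => g * γ t) (mulInvariantVectorField X) s := by
  intro t ht
  have h1 : ∀ a x : G, MDifferentiableAt 𝓘(ℝ, E) 𝓘(ℝ, E) (fun y : G => a * y) x := fun a x =>
    (contMDiff_mul_left (I := 𝓘(ℝ, E)) (n := ∞)).mdifferentiableAt (by simp)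
  have h2 := (h1 g (γ t)).hasMFDerivAt.comp_hasMFDerivWithinAt t (h t ht)
  have h3 : mulInvariantVectorField X (g * γ t)
      = mfderiv 𝓘(ℝ, E) 𝓘(ℝ, E) (fun y : G => g * y) (γ t) (mulInvariantVectorField X (γ t)) := by
    have hc : (fun y : G => (g * γ t) * y) = (fun y : G => g * y) ∘ (fun y : G => γ t * y) := by
      funext y; simp [mul_assoc]
    have hd := mfderiv_comp (I := 𝓘(ℝ, E)) (I' := 𝓘(ℝ, E)) (I'' := 𝓘(ℝ, E)) (1 : G)
      (g := fun y : G => g * y) (f := fun y : G => γ t * y) (h1 g _) (h1 (γ t) 1)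
    rw [← hc] at hd
    unfold mulInvariantVectorField
    rw [hd]
    have key : ∀ y z : G, y = z → ∀ w : E,
        (mfderiv 𝓘(ℝ, E) 𝓘(ℝ, E) (fun x : G => g * x) y : E →L[ℝ] E) w
          = (mfderiv 𝓘(ℝ, E) 𝓘(ℝ, E) (fun x : G => g * x) z : E →L[ℝ] E) w := by
      rintro y _ rfl w; rfl
    exact key _ _ (mul_one _) _
  refine h2.congr_mfderiv ?_
  rw [h3]
  have key : ∀ (L : E →L[ℝ] E) (w : E),
      L.comp (ContinuousLinearMap.smulRight (1 : ℝ →L[ℝ] ℝ) w)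
        = ContinuousLinearMap.smulRight (1 : ℝ →L[ℝ] ℝ) (L w) := by
    intro L w; ext; simp
  exact key _ _

/-- Every element of the Lie algebra is the initial velocity of a one-parameter subgroup. -/
theorem exists_isOneParameterSubgroup [CompleteSpace E] [T2Space G] [LieGroup 𝓘(ℝ, E) ∞ G]
    (X : GroupLieAlgebra 𝓘(ℝ, E) G) : ∃ γ : ℝ → G, IsOneParameterSubgroup X γ := by
  have hv := (contMDiff_mulInvariantVectorField (I := 𝓘(ℝ, E)) (G := G) X).of_le
    (show (1 : ℕ∞ω) ≤ minSmoothness ℝ 2 by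
      rw [minSmoothness_of_isRCLikeNormedField]; norm_num)
  have : IsManifold 𝓘(ℝ, E) 1 G := inferInstance
  obtain ⟨γ, h0, hγ⟩ := exists_isMIntegralCurveAt_of_contMDiffAt_boundaryless (t₀ := 0)
    (hv.contMDiffAt (x := (1 : G)))
  rw [isMIntegralCurveAt_iff'] at hγ
  obtain ⟨ε, hε, hγ⟩ := hγ
  rw [Real.ball_eq_Ioo, zero_sub, zero_add] at hγ
  exact exists_isMIntegralCurve_of_isMIntegralCurveOn hv hε
    (fun x => ⟨fun t => x * γ t, by simp [h0], hγ.left_translate x⟩) 1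

/-- The one-parameter subgroup with a given initial velocity is unique. -/
theorem IsOneParameterSubgroup.unique [CompleteSpace E] [T2Space G] [LieGroup 𝓘(ℝ, E) ∞ G]
    {X : GroupLieAlgebra 𝓘(ℝ, E) G} {γ γ' : ℝ → G} (h : IsOneParameterSubgroup X γ)
    (h' : IsOneParameterSubgroup X γ') : γ = γ' := by
  have hv := (contMDiff_mulInvariantVectorField (I := 𝓘(ℝ, E)) (G := G) X).of_le
    (show (1 : ℕ∞ω) ≤ minSmoothness ℝ 2 by
      rw [minSmoothness_of_isRCLikeNormedField]; norm_num)
  exact isMIntegralCurve_Ioo_eq_of_contMDiff_boundaryless (t₀ := 0) hv h.2 h'.2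
    (h.1.trans h'.1.symm)

/-- The exponential map `Lie(G) → G` of a Lie group: `exp X` is the value at time `1` of the
one-parameter subgroup with initial velocity `X`. -/
noncomputable def lieExp [CompleteSpace E] [T2Space G] [LieGroup 𝓘(ℝ, E) ∞ G]
    (X : GroupLieAlgebra 𝓘(ℝ, E) G) : G :=
  (exists_isOneParameterSubgroup X).choose 1

theorem IsOneParameterSubgroup.lieExp_eq [CompleteSpace E] [T2Space G] [LieGroup 𝓘(ℝ, E) ∞ G]
    {X : GroupLieAlgebra 𝓘(ℝ, E) G} {γ : ℝ → G} (h : IsOneParameterSubgroup X γ) :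
    lieExp X = γ 1 :=
  congrFun ((exists_isOneParameterSubgroup X).choose_spec.unique h) 1

end LieExp

/-- A stratification of step `s` of a real Lie algebra `L`: a decomposition
`L = L₁ ⊕ ⋯ ⊕ Lₛ` into linear subspaces with `[L₁, Lᵢ] = Lᵢ₊₁` for `1 ≤ i ≤ s - 1`, `Lₛ ≠ 0` and
`[L₁, Lₛ] = 0`. The layers are indexed by `ℕ`, those with index outside `{1, …, s}` being zero.
Here `[A, B]` is the linear span of all brackets of elements of `A` with elements of `B`. -/
structure LieStratification (L : Type*) [LieRing L] [LieAlgebra ℝ L] (s : ℕ) where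
  layer : ℕ → Submodule ℝ L
  layer_zero : layer 0 = ⊥
  layer_of_gt : ∀ i, s < i → layer i = ⊥
  isInternal : DirectSum.IsInternal layer
  span_lie : ∀ i, 1 ≤ i → i < s →
    Submodule.span ℝ {z : L | ∃ x ∈ layer 1, ∃ y ∈ layer i, ⁅x, y⁆ = z} = layer (i + 1)
  layer_last_ne_bot : layer s ≠ ⊥
  lie_last : ∀ x ∈ layer 1, ∀ y ∈ layer s, ⁅x, y⁆ = 0

/-- The horizontal layer of a stratified Lie algebra. -/
abbrev LieStratification.horizontal {L : Type*} [LieRing L] [LieAlgebra ℝ L] {s : ℕ}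
    (V : LieStratification L s) : Submodule ℝ L := V.layer 1

/-- A scalar product on a real vector space: a symmetric positive definite bilinear form. -/
structure IsScalarProduct {V : Type*} [AddCommGroup V] [Module ℝ V]
    (B : LinearMap.BilinForm ℝ V) : Prop where
  symm : ∀ x y, B x y = B y x
  pos : ∀ x, x ≠ 0 → 0 < B x x

/-- The unit sphere of a bilinear form. -/
def bilinUnitSphere {V : Type*} [AddCommGroup V] [Module ℝ V]
    (B : LinearMap.BilinForm ℝ V) : Set V :=
  {x | B x x = 1}

/-- The closed half-space `ν^⊥ + ℝ⁺ν`, where `ℝ⁺ = [0, ∞)`. -/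
def normalHalfSpace {V : Type*} [AddCommGroup V] [Module ℝ V]
    (B : LinearMap.BilinForm ℝ V) (ν : V) : Set V :=
  {Y | ∃ Z : V, B ν Z = 0 ∧ ∃ t : ℝ, 0 ≤ t ∧ Y = Z + t • ν}

/-- The semigroup `S_ν` of horizontal normal `ν`: the subsemigroup of `G` generated by
`exp (ν^⊥ + ℝ⁺ν)`, the orthogonal space being taken inside the horizontal layer `W`. -/
noncomputable def semigroupOfNormal {E : Type*} [NormedAddCommGroup E] [NormedSpace ℝ E]
    [CompleteSpace E] {G : Type*} [TopologicalSpace G] [T2Space G] [ChartedSpace E G] [Group G]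
    [LieGroup 𝓘(ℝ, E) ∞ G] {W : Submodule ℝ (GroupLieAlgebra 𝓘(ℝ, E) G)}
    (B : LinearMap.BilinForm ℝ W) (ν : W) : Set G :=
  (Subsemigroup.closure ((fun Y : W => lieExp (Y : GroupLieAlgebra 𝓘(ℝ, E) G)) ''
    normalHalfSpace B ν) : Set G)

/-! Fix `ν`. For a finite set `F` of horizontal vectors with `B ν Y > 0`, the inequalities `B μ Y >
0`, `Y ∈ F`, hold for all `μ` in a neighbourhood `U` of `ν`. Hence the monoid `M_F` generated by the
half-lines `exp (t Y)`, `Y ∈ F`, lies in every `S_μ`, `μ ∈ U`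
(`subset_interior_iInter_semigroupOfNormal`). It remains to produce interior points of such monoids.

If `F` also spans the first layer, it generates the Lie algebra, and an accessibility theorem of
Krener type (`exists_mem_interior_controlMonoid`) gives interior points of `M_F` arbitrarily near
`1`. Its proof takes a family in `M_F` whose tangent space `H` has maximal dimension. By maximality
`H` contains `Ad_u Y` for `Y ∈ F` and the relevant `u ∈ M_F`. Differentiating `Ad` along `exp (t Y)`
adds brackets, so `H` is everything and surjectivity of the derivative yields an open set.

For the second claim, let `g = exp X` be interior to `S_ν` and take `p` interior to `M_F`, so close
to `1` that `g p⁻¹ ∈ S_ν`. Moving generators into the open half-space approximates `g p⁻¹` by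
elements `h` of some `M_F'` (`exists_horizontalMonoid_mem_of_mem_semigroupOfNormal`). For `h` close
enough, `h⁻¹ g` is interior to `M_F`, so `g` is interior to `M_(F ∪ F')`. -/

/-! ### Multiplication, conjugation and left-invariant fields in a chart at the identity. -/

section ChartAtOne

open Filter VectorField

variable {E : Type*} [NormedAddCommGroup E] [NormedSpace ℝ E]
  {G : Type*} [TopologicalSpace G] [ChartedSpace E G] [Group G]

variable (E G) in
/-- The preferred chart of the Lie group `G` at the identity. -/
noncomputable abbrev chartOne : PartialEquiv G E := extChartAt 𝓘(ℝ, E) (1 : G)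

variable (G) in
/-- The multiplication of the Lie group `G`, read in the chart at the identity. -/
noncomputable def chartMul (x y : E) : E :=
  chartOne E G ((chartOne E G).symm x * (chartOne E G).symm y)

/-- The conjugation by `c`, read in the chart at the identity. -/
noncomputable def chartConj (c : G) (x : E) : E :=
  chartOne E G (c * (chartOne E G).symm x * c⁻¹)

variable (E) in
/-- The adjoint action of `c` on the tangent space at the identity. -/
noncomputable def adjointAction (c : G) : E →L[ℝ] E :=
  fderiv ℝ (chartConj c) (chartOne E G 1)

theorem chartOne_symm_one : (chartOne E G).symm (chartOne E G 1) = 1 :=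
  extChartAt_to_inv (I := 𝓘(ℝ, E)) (1 : G)

theorem chartOne_one_mem_target : chartOne E G 1 ∈ (chartOne E G).target :=
  mem_extChartAt_target (I := 𝓘(ℝ, E)) (1 : G)

theorem chartOne_target_mem_nhds : (chartOne E G).target ∈ 𝓝 (chartOne E G 1) :=
  extChartAt_target_mem_nhds (I := 𝓘(ℝ, E)) (1 : G)

theorem chartOne_source_mem_nhds : (chartOne E G).source ∈ 𝓝 (1 : G) :=
  extChartAt_source_mem_nhds (I := 𝓘(ℝ, E)) (1 : G)

theorem continuousAt_chartOne_symm :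
    ContinuousAt (chartOne E G).symm (chartOne E G 1) :=
  continuousAt_extChartAt_symm (I := 𝓘(ℝ, E)) (1 : G)

theorem chartMul_one_left {x : E} (hx : x ∈ (chartOne E G).target) :
    chartMul G (chartOne E G 1) x = x := by
  simp only [chartMul, chartOne_symm_one, one_mul]
  exact (chartOne E G).right_inv hx

theorem chartMul_one_right {x : E} (hx : x ∈ (chartOne E G).target) :
    chartMul G x (chartOne E G 1) = x := by
  simp only [chartMul, chartOne_symm_one, mul_one]
  exact (chartOne E G).right_inv hx

theorem chartConj_chartOne_one (c : G) : chartConj c (chartOne E G 1) = chartOne E G 1 := by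
  simp only [chartConj, chartOne_symm_one, mul_one, mul_inv_cancel]

variable [LieGroup 𝓘(ℝ, E) ∞ G]

theorem contMDiffAt_chartOne {g : G} (hg : g ∈ (chartOne E G).source) :
    ContMDiffAt 𝓘(ℝ, E) 𝓘(ℝ, E) ∞ (chartOne E G) g := by
  have : IsManifold 𝓘(ℝ, E) ∞ G := inferInstance
  exact contMDiffAt_extChartAt' (by rwa [extChartAt_source] at hg)

theorem contMDiffAt_chartOne_symm {x : E} (hx : x ∈ (chartOne E G).target) :
    ContMDiffAt 𝓘(ℝ, E) 𝓘(ℝ, E) ∞ (chartOne E G).symm x := by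
  have : IsManifold 𝓘(ℝ, E) ∞ G := inferInstance
  exact (contMDiffOn_extChartAt_symm (1 : G)).contMDiffAt
    ((isOpen_extChartAt_target (1 : G)).mem_nhds hx)

theorem contDiffAt_chartMul {x y : E} (hx : x ∈ (chartOne E G).target)
    (hy : y ∈ (chartOne E G).target)
    (hxy : (chartOne E G).symm x * (chartOne E G).symm y ∈ (chartOne E G).source) :
    ContDiffAt ℝ ∞ (fun p : E × E => chartMul G p.1 p.2) (x, y) := by
  rw [← contMDiffAt_iff_contDiffAt]
  have h1 : ContMDiffAt 𝓘(ℝ, E × E) 𝓘(ℝ, E) ∞ (fun p : E × E => (chartOne E G).symm p.1) (x, y) :=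
    (contMDiffAt_chartOne_symm hx).comp (x, y) (contDiff_fst.contMDiff.contMDiffAt)
  have h2 : ContMDiffAt 𝓘(ℝ, E × E) 𝓘(ℝ, E) ∞ (fun p : E × E => (chartOne E G).symm p.2) (x, y) :=
    (contMDiffAt_chartOne_symm hy).comp (x, y) (contDiff_snd.contMDiff.contMDiffAt)
  exact (contMDiffAt_chartOne hxy).comp (x, y) (h1.mul h2)

theorem contDiffAt_chartMul_right {x : E} (hx : x ∈ (chartOne E G).target) :
    ContDiffAt ℝ ∞ (fun p : E × E => chartMul G p.1 p.2) (x, chartOne E G 1) :=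
  contDiffAt_chartMul hx chartOne_one_mem_target (by
    rw [chartOne_symm_one, mul_one]; exact (chartOne E G).map_target hx)

theorem contDiffAt_chartMul_left {x : E} (hx : x ∈ (chartOne E G).target) :
    ContDiffAt ℝ ∞ (fun p : E × E => chartMul G p.1 p.2) (chartOne E G 1, x) :=
  contDiffAt_chartMul chartOne_one_mem_target hx (by
    rw [chartOne_symm_one, one_mul]; exact (chartOne E G).map_target hx)

theorem contDiffAt_chartConj (c : G) : ContDiffAt ℝ ∞ (chartConj c) (chartOne E G 1) := by
  rw [← contMDiffAt_iff_contDiffAt]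
  have h1 := contMDiffAt_chartOne_symm (G := G) (chartOne_one_mem_target (E := E))
  have h2 : ContMDiffAt 𝓘(ℝ, E) 𝓘(ℝ, E) ∞
      (fun x : E => c * (chartOne E G).symm x * c⁻¹) (chartOne E G 1) :=
    (contMDiffAt_const.mul h1).mul contMDiffAt_const
  refine ContMDiffAt.comp _ (contMDiffAt_chartOne ?_) h2
  simp only [chartOne_symm_one, mul_one, mul_inv_cancel]
  exact mem_of_mem_nhds chartOne_source_mem_nhds

theorem hasStrictFDerivAt_chartConj (c : G) :
    HasStrictFDerivAt (chartConj c) (adjointAction E c) (chartOne E G 1) :=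
  (contDiffAt_chartConj c).hasStrictFDerivAt (by simp)

omit [LieGroup 𝓘(ℝ, E) ∞ G] in
theorem adjointAction_one : adjointAction E (1 : G) = ContinuousLinearMap.id ℝ E := by
  have : chartConj (1 : G) =ᶠ[𝓝 (chartOne E G 1)] id := by
    filter_upwards [chartOne_target_mem_nhds (G := G)] with x hx
    simpa [chartConj] using (chartOne E G).right_inv hx
  rw [adjointAction, this.fderiv_eq, fderiv_id]

omit [LieGroup 𝓘(ℝ, E) ∞ G] in
theorem continuousAt_conj_chartOne_symm [IsTopologicalGroup G] (c : G) :
    Tendsto (fun x => c * (chartOne E G).symm x * c⁻¹) (𝓝 (chartOne E G 1)) (𝓝 1) := by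
  have h : ContinuousAt (fun x => c * (chartOne E G).symm x * c⁻¹) (chartOne E G 1) :=
    (continuousAt_const.mul continuousAt_chartOne_symm).mul continuousAt_const
  simpa [ContinuousAt, chartOne_symm_one] using h

/-- Chain rule: conjugations compose in the chart wherever the inner one stays in the chart domain,
which suffices near the identity. -/
theorem adjointAction_mul [IsTopologicalGroup G] (c d : G) :
    adjointAction E (c * d) = (adjointAction E c).comp (adjointAction E d) := by
  have h : chartConj (c * d) =ᶠ[𝓝 (chartOne E G 1)] chartConj c ∘ chartConj d := by
    filter_upwards [(continuousAt_conj_chartOne_symm d).eventually_mem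
      (chartOne_source_mem_nhds (E := E))] with x hx
    simp only [chartConj, Function.comp_apply]
    rw [(chartOne E G).left_inv hx]
    simp only [mul_inv_rev, mul_assoc]
  have h1 := (hasStrictFDerivAt_chartConj (E := E) d).hasFDerivAt
  have h2 := (hasStrictFDerivAt_chartConj (E := E) c).hasFDerivAt
  rw [← chartConj_chartOne_one d] at h2
  exact ((h2.comp _ h1).congr_of_eventuallyEq h).fderiv

theorem mfderiv_chartOne_one :
    (mfderiv 𝓘(ℝ, E) 𝓘(ℝ, E) (chartOne E G) 1 : E →L[ℝ] E) = ContinuousLinearMap.id ℝ E := by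
  have : IsManifold 𝓘(ℝ, E) 1 G := inferInstance
  exact mfderiv_extChartAt_self

/-- The map `y ↦ chart (g * y)` is differentiated at `1` in two ways; the chart itself has
derivative the identity there. -/
theorem mfderiv_chartOne_mulInvariantVectorField (v : GroupLieAlgebra 𝓘(ℝ, E) G) {g : G}
    (hg : g ∈ (chartOne E G).source) :
    (mfderiv 𝓘(ℝ, E) 𝓘(ℝ, E) (chartOne E G) g : E →L[ℝ] E) (mulInvariantVectorField v g)
      = fderiv ℝ (chartMul G (chartOne E G g)) (chartOne E G 1) v := by
  have hs : (1 : G) ∈ (chartOne E G).source := mem_of_mem_nhds chartOne_source_mem_nhds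
  have hd : DifferentiableAt ℝ (chartMul G (chartOne E G g)) (chartOne E G 1) := by
    have h := contDiffAt_chartMul_right (G := G) ((chartOne E G).map_source hg)
    exact (h.comp (chartOne E G 1) (contDiffAt_const.prodMk contDiffAt_id)).differentiableAt
      (by simp)
  have h1 : HasMFDerivAt 𝓘(ℝ, E) 𝓘(ℝ, E) (chartMul G (chartOne E G g) ∘ chartOne E G) 1
      ((fderiv ℝ (chartMul G (chartOne E G g)) (chartOne E G 1)).comp
        (mfderiv 𝓘(ℝ, E) 𝓘(ℝ, E) (chartOne E G) 1 : E →L[ℝ] E)) :=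
    HasMFDerivAt.comp (1 : G) hd.hasFDerivAt.hasMFDerivAt
      ((contMDiffAt_chartOne hs).mdifferentiableAt (by simp)).hasMFDerivAt
  have hL : MDifferentiableAt 𝓘(ℝ, E) 𝓘(ℝ, E) (fun y : G => g * y) 1 :=
    (contMDiff_mul_left (I := 𝓘(ℝ, E)) (n := ∞)).mdifferentiableAt (by simp)
  have hg' : g * 1 ∈ (chartOne E G).source := by rwa [mul_one]
  have h2 : HasMFDerivAt 𝓘(ℝ, E) 𝓘(ℝ, E) (chartOne E G ∘ (fun y : G => g * y)) 1
      ((mfderiv 𝓘(ℝ, E) 𝓘(ℝ, E) (chartOne E G) (g * 1) : E →L[ℝ] E).comp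
        (mfderiv 𝓘(ℝ, E) 𝓘(ℝ, E) (fun y : G => g * y) 1)) :=
    HasMFDerivAt.comp (1 : G)
      ((contMDiffAt_chartOne hg').mdifferentiableAt (by simp)).hasMFDerivAt hL.hasMFDerivAt
  have h3 : chartMul G (chartOne E G g) ∘ chartOne E G =ᶠ[𝓝 1]
      chartOne E G ∘ (fun y : G => g * y) := by
    filter_upwards [chartOne_source_mem_nhds (E := E) (G := G)] with y hy
    simp only [Function.comp_apply, chartMul]
    rw [(chartOne E G).left_inv hg, (chartOne E G).left_inv hy]
  have h4 := hasMFDerivAt_unique (h2.congr_of_eventuallyEq h3) h1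
  rw [mfderiv_chartOne_one] at h4
  have h5 := congrArg (fun L : E →L[ℝ] E => L v) h4
  -- The tangent spaces at `g` and `g * 1` are not syntactically equal, so the base point is moved
  -- by substitution.
  have key : ∀ y z : G, y = z → ∀ w : E,
      (mfderiv 𝓘(ℝ, E) 𝓘(ℝ, E) (chartOne E G) y : E →L[ℝ] E) w
        = (mfderiv 𝓘(ℝ, E) 𝓘(ℝ, E) (chartOne E G) z : E →L[ℝ] E) w := by
    rintro y _ rfl w; rfl
  exact (key g (g * 1) (mul_one g).symm _).trans h5

/-- The left-invariant vector field generated by `v`, read in the chart at the identity. -/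
theorem mpullbackWithin_mulInvariantVectorField (v : GroupLieAlgebra 𝓘(ℝ, E) G) {x : E}
    (hx : x ∈ (chartOne E G).target) :
    mpullbackWithin 𝓘(ℝ, E) 𝓘(ℝ, E) (chartOne E G).symm (mulInvariantVectorField v)
      (range 𝓘(ℝ, E)) x = fderiv ℝ (chartMul G x) (chartOne E G 1) v := by
  have : IsManifold 𝓘(ℝ, E) 1 G := inferInstance
  have h1 := mfderiv_chartOne_mulInvariantVectorField v ((chartOne E G).map_target hx)
  rw [(chartOne E G).right_inv hx] at h1
  rw [← h1, mpullbackWithin_apply]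
  congr 1
  exact ContinuousLinearMap.inverse_eq
    (mfderivWithin_extChartAt_symm_comp_mfderiv_extChartAt hx)
    (mfderiv_extChartAt_comp_mfderivWithin_extChartAt_symm hx)

theorem lie_eq_lieBracket (v w : GroupLieAlgebra 𝓘(ℝ, E) G) :
    (⁅v, w⁆ : GroupLieAlgebra 𝓘(ℝ, E) G) =
      lieBracket ℝ (fun x => fderiv ℝ (chartMul G x) (chartOne E G 1) v)
        (fun x => fderiv ℝ (chartMul G x) (chartOne E G 1) w) (chartOne E G 1) := by
  rw [GroupLieAlgebra.bracket_def, ← mlieBracketWithin_univ, mlieBracketWithin_apply]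
  have hV : ∀ u : GroupLieAlgebra 𝓘(ℝ, E) G,
      mpullbackWithin 𝓘(ℝ, E) 𝓘(ℝ, E) (chartOne E G).symm (mulInvariantVectorField u)
      (range 𝓘(ℝ, E)) =ᶠ[𝓝 (chartOne E G 1)]
        fun x => fderiv ℝ (chartMul G x) (chartOne E G 1) u := fun u => by
    filter_upwards [chartOne_target_mem_nhds (G := G)] with x hx
    exact mpullbackWithin_mulInvariantVectorField u hx
  have h1 := Filter.EventuallyEq.lieBracket_vectorField_eq (𝕜 := ℝ) (hV v) (hV w)
  have h2 : (mfderiv 𝓘(ℝ, E) 𝓘(ℝ, E) (chartOne E G) 1 : E →L[ℝ] E).inverse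
      = ContinuousLinearMap.id ℝ E := by
    rw [mfderiv_chartOne_one]; exact ContinuousLinearMap.inverse_id
  have h3 : (chartOne E G).symm ⁻¹' univ ∩ range 𝓘(ℝ, E) = univ := by simp
  rw [← h1]
  refine (congrArg (fun L : E →L[ℝ] E => L _) h2).trans ?_
  refine (congrArg (fun s => lieBracketWithin ℝ _ _ s (chartOne E G 1)) h3).trans ?_
  exact congrFun (lieBracketWithin_univ (𝕜 := ℝ) (E := E)) _

end ChartAtOne

/-! ### One-parameter subgroups, and the bracket as derivative of the adjoint action. -/

section OneParameter

open Filter VectorField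

variable {E : Type*} [NormedAddCommGroup E] [NormedSpace ℝ E]
  {G : Type*} [TopologicalSpace G] [ChartedSpace E G] [Group G] [LieGroup 𝓘(ℝ, E) ∞ G]

theorem one_add_one_le_infty : (1 : ℕ∞ω) + 1 ≤ ∞ := by
  rw [one_add_one_eq_two]; exact WithTop.coe_le_coe.mpr le_top

theorem contDiffAt_fderiv_chartMul {x : E} (hx : x ∈ (chartOne E G).target) :
    ContDiffAt ℝ 1 (fun x => fderiv ℝ (chartMul G x) (chartOne E G 1)) x :=
  ContDiffAt.fderiv (n := ∞) (m := 1) (f := fun x y => chartMul G x y)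
    (g := fun _ => chartOne E G 1) (contDiffAt_chartMul_right hx) contDiffAt_const
    one_add_one_le_infty

theorem contDiffAt_fderiv_chartMul_swap {x : E} (hx : x ∈ (chartOne E G).target) :
    ContDiffAt ℝ 1 (fun x => fderiv ℝ (fun y => chartMul G y x) (chartOne E G 1)) x := by
  refine ContDiffAt.fderiv (n := ∞) (m := 1) (f := fun x y => chartMul G y x)
    (g := fun _ => chartOne E G 1) ?_ contDiffAt_const
    one_add_one_le_infty
  exact ContDiffAt.comp (g := fun p : E × E => chartMul G p.1 p.2) (x, chartOne E G 1)
    (contDiffAt_chartMul_left hx)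
    (contDiffAt_snd.prodMk contDiffAt_fst)

omit [LieGroup 𝓘(ℝ, E) ∞ G] in
theorem fderiv_chartMul_one :
    fderiv ℝ (chartMul G (chartOne E G 1)) (chartOne E G 1) = ContinuousLinearMap.id ℝ E := by
  have : chartMul G (chartOne E G 1) =ᶠ[𝓝 (chartOne E G 1)] id := by
    filter_upwards [chartOne_target_mem_nhds (G := G)] with x hx using chartMul_one_left hx
  rw [this.fderiv_eq, fderiv_id]

omit [LieGroup 𝓘(ℝ, E) ∞ G] in
theorem fderiv_chartMul_swap_one :
    fderiv ℝ (fun y => chartMul G y (chartOne E G 1)) (chartOne E G 1)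
      = ContinuousLinearMap.id ℝ E := by
  have : (fun y => chartMul G y (chartOne E G 1)) =ᶠ[𝓝 (chartOne E G 1)] id := by
    filter_upwards [chartOne_target_mem_nhds (G := G)] with x hx using chartMul_one_right hx
  rw [this.fderiv_eq, fderiv_id]

theorem fderiv_chartMul_eq {x : E} (hx : x ∈ (chartOne E G).target) :
    fderiv ℝ (chartMul G x) (chartOne E G 1)
      = (fderiv ℝ (fun p : E × E => chartMul G p.1 p.2) (x, chartOne E G 1)).comp
        (ContinuousLinearMap.inr ℝ E E) := by
  have h := ((contDiffAt_chartMul_right hx).differentiableAt (by simp)).hasFDerivAt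
  exact (HasFDerivAt.comp (g := fun p : E × E => chartMul G p.1 p.2) (chartOne E G 1) h
    (hasFDerivAt_prodMk_right x (chartOne E G 1))).fderiv

theorem fderiv_chartMul_swap_eq {x : E} (hx : x ∈ (chartOne E G).target) :
    fderiv ℝ (fun y => chartMul G y x) (chartOne E G 1)
      = (fderiv ℝ (fun p : E × E => chartMul G p.1 p.2) (chartOne E G 1, x)).comp
        (ContinuousLinearMap.inl ℝ E E) := by
  have h := ((contDiffAt_chartMul_left hx).differentiableAt (by simp)).hasFDerivAt
  exact (HasFDerivAt.comp (g := fun p : E × E => chartMul G p.1 p.2) (chartOne E G 1) h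
    (hasFDerivAt_prodMk_left (𝕜 := ℝ) (chartOne E G 1) x)).fderiv

/-- Both sides are the mixed second derivative of the multiplication at the identity, so this is
symmetry of second derivatives. -/
theorem fderiv_fderiv_chartMul_comm (v w : E) :
    fderiv ℝ (fun x => fderiv ℝ (chartMul G x) (chartOne E G 1)) (chartOne E G 1) v w
      = fderiv ℝ (fun x => fderiv ℝ (fun y => chartMul G y x) (chartOne E G 1))
        (chartOne E G 1) w v := by
  set e := chartOne E G 1 with he
  set M := fun p : E × E => chartMul G p.1 p.2
  have hM : ContDiffAt ℝ ∞ M (e, e) := contDiffAt_chartMul_right chartOne_one_mem_target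
  have hsymm : IsSymmSndFDerivAt ℝ M (e, e) := hM.isSymmSndFDerivAt (by
    rw [minSmoothness_of_isRCLikeNormedField]; exact WithTop.coe_le_coe.mpr le_top)
  have hM' : HasFDerivAt (fderiv ℝ M) (fderiv ℝ (fderiv ℝ M) (e, e)) (e, e) :=
    ((hM.fderiv_right (m := 1) one_add_one_le_infty).differentiableAt
      (by simp)).hasFDerivAt
  have h1 : (fun x => fderiv ℝ (chartMul G x) e) =ᶠ[𝓝 e]
      fun x => (fderiv ℝ M (x, e)).comp (ContinuousLinearMap.inr ℝ E E) := by
    filter_upwards [chartOne_target_mem_nhds (G := G)] with x hx using fderiv_chartMul_eq hx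
  have h2 : (fun x => fderiv ℝ (fun y => chartMul G y x) e) =ᶠ[𝓝 e]
      fun x => (fderiv ℝ M (e, x)).comp (ContinuousLinearMap.inl ℝ E E) := by
    filter_upwards [chartOne_target_mem_nhds (G := G)] with x hx using fderiv_chartMul_swap_eq hx
  have h1' : HasFDerivAt (fun x => fderiv ℝ M (x, e)) _ e :=
    HasFDerivAt.comp (g := fderiv ℝ M) e hM' (hasFDerivAt_prodMk_left e e)
  have h2' : HasFDerivAt (fun x => fderiv ℝ M (e, x)) _ e :=
    HasFDerivAt.comp (g := fderiv ℝ M) e hM' (hasFDerivAt_prodMk_right e e)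
  rw [h1.fderiv_eq, h2.fderiv_eq, (h1'.clm_comp (hasFDerivAt_const _ _)).fderiv,
    (h2'.clm_comp (hasFDerivAt_const _ _)).fderiv]
  simp
  exact hsymm.eq _ _

variable (G) in
/-- The bracket of the Lie algebra of `G`, on the model space. -/
noncomputable def modelBracket (v w : E) : E :=
  @Bracket.bracket (GroupLieAlgebra 𝓘(ℝ, E) G) (GroupLieAlgebra 𝓘(ℝ, E) G) _ v w

theorem modelBracket_eq (v w : E) :
    modelBracket G v w =
      fderiv ℝ (fun x => fderiv ℝ (chartMul G x) (chartOne E G 1)) (chartOne E G 1) v w -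
      fderiv ℝ (fun x => fderiv ℝ (fun y => chartMul G y x) (chartOne E G 1))
        (chartOne E G 1) v w := by
  have h := ((contDiffAt_fderiv_chartMul (G := G) (E := E) chartOne_one_mem_target).differentiableAt
    (by simp)).hasFDerivAt
  have h' : ∀ u : E, fderiv ℝ (fun x => fderiv ℝ (chartMul G x) (chartOne E G 1) u)
      (chartOne E G 1) = (fderiv ℝ (fun x => fderiv ℝ (chartMul G x) (chartOne E G 1))
      (chartOne E G 1)).flip u := fun u => by
    rw [(h.clm_apply (hasFDerivAt_const u _)).fderiv]
    ext; simp
  refine (lie_eq_lieBracket (G := G) v w).trans ?_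
  rw [lieBracket, h', h', fderiv_chartMul_one, ← fderiv_fderiv_chartMul_comm]
  rfl

omit [LieGroup 𝓘(ℝ, E) ∞ G] in
theorem IsOneParameterSubgroup.comp_mul {X : GroupLieAlgebra 𝓘(ℝ, E) G} {γ : ℝ → G}
    (h : IsOneParameterSubgroup X γ) (t : ℝ) : IsOneParameterSubgroup (t • X) (γ ∘ (· * t)) := by
  refine ⟨by simp [h.1], ?_⟩
  rw [mulInvariantVectorField_smul]
  exact h.2.comp_mul t

variable [CompleteSpace E] [T2Space G]

variable (G) in
/-- The exponential map of `G`, on the model space. -/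
noncomputable def modelExp (Y : E) : G := lieExp (G := G) (E := E) Y

theorem isOneParameterSubgroup_modelExp (Y : E) :
    IsOneParameterSubgroup (Y : GroupLieAlgebra 𝓘(ℝ, E) G) (fun t : ℝ => modelExp G (t • Y)) := by
  obtain ⟨γ, hγ⟩ := exists_isOneParameterSubgroup (E := E) (G := G) Y
  have h : (fun t : ℝ => modelExp G (t • Y)) = γ := by
    funext t
    have h1 : IsOneParameterSubgroup (E := E) (G := G) (t • Y) (γ ∘ (· * t)) := hγ.comp_mul t
    refine (h1.lieExp_eq).trans ?_
    simp
  rw [h]; exact hγ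

theorem modelExp_zero : modelExp G (0 : E) = 1 := by
  have := (isOneParameterSubgroup_modelExp (G := G) (0 : E)).1
  simpa using this

theorem continuous_modelExp_smul (Y : E) : Continuous (fun t : ℝ => modelExp G (t • Y)) :=
  (isOneParameterSubgroup_modelExp Y).2.continuous

omit [CompleteSpace E] [T2Space G] in
theorem contMDiff_one_mulInvariantVectorField (Y : GroupLieAlgebra 𝓘(ℝ, E) G) :
    ContMDiff 𝓘(ℝ, E) 𝓘(ℝ, E).tangent 1
      (fun g : G => (⟨g, mulInvariantVectorField Y g⟩ : TangentBundle 𝓘(ℝ, E) G)) :=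
  (contMDiff_mulInvariantVectorField (I := 𝓘(ℝ, E)) (G := G) Y).of_le
    (show (1 : ℕ∞ω) ≤ minSmoothness ℝ 2 by
      rw [minSmoothness_of_isRCLikeNormedField]; norm_num)

/-- As functions of `t` both sides are integral curves of the same left-invariant field, and they
agree at `t = 0`. -/
theorem modelExp_add_smul (Y : E) (s t : ℝ) :
    modelExp G ((s + t) • Y) = modelExp G (s • Y) * modelExp G (t • Y) := by
  have hY := isOneParameterSubgroup_modelExp (G := G) Y
  have h1 := hY.2.comp_add s
  have h2 : IsMIntegralCurve (I := 𝓘(ℝ, E)) (fun t : ℝ => modelExp G (s • Y) * modelExp G (t • Y))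
      (mulInvariantVectorField (Y : GroupLieAlgebra 𝓘(ℝ, E) G)) := by
    rw [isMIntegralCurve_iff_isMIntegralCurveOn]
    exact (hY.2.isMIntegralCurveOn univ).left_translate _
  have : IsManifold 𝓘(ℝ, E) 1 G := inferInstance
  have h3 := isMIntegralCurve_Ioo_eq_of_contMDiff_boundaryless (t₀ := 0)
    (contMDiff_one_mulInvariantVectorField Y) h1 h2 (by simp [modelExp_zero])
  have := congrFun h3 t
  simpa [add_comm] using this

theorem hasDerivAt_chartOne_modelExp (Y : E) {t : ℝ}
    (ht : modelExp G (t • Y) ∈ (chartOne E G).source) :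
    HasDerivAt (fun t : ℝ => chartOne E G (modelExp G (t • Y)))
      (fderiv ℝ (chartMul G (chartOne E G (modelExp G (t • Y)))) (chartOne E G 1) Y) t := by
  have h1 := (isOneParameterSubgroup_modelExp (G := G) Y).2 t
  have h2 := ((contMDiffAt_chartOne ht).mdifferentiableAt (by simp)).hasMFDerivAt
  have h3 := HasMFDerivAt.comp t h2 h1
  have h4 : HasFDerivAt (fun t : ℝ => chartOne E G (modelExp G (t • Y)))
      ((mfderiv 𝓘(ℝ, E) 𝓘(ℝ, E) (chartOne E G) (modelExp G (t • Y)) : E →L[ℝ] E).comp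
        ((1 : ℝ →L[ℝ] ℝ).smulRight (mulInvariantVectorField (Y : GroupLieAlgebra 𝓘(ℝ, E) G)
          (modelExp G (t • Y)) : E))) t := hasMFDerivAt_iff_hasFDerivAt.mp h3
  have h5 := mfderiv_chartOne_mulInvariantVectorField
    (Y : GroupLieAlgebra 𝓘(ℝ, E) G) ht
  convert! h4.hasDerivAt using 1
  refine h5.symm.trans ?_
  exact (congrArg (mfderiv 𝓘(ℝ, E) 𝓘(ℝ, E) (chartOne E G) (modelExp G (t • Y)) : E →L[ℝ] E)
    (one_smul ℝ (mulInvariantVectorField (Y : GroupLieAlgebra 𝓘(ℝ, E) G)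
      (modelExp G (t • Y)) : E))).symm

theorem eventually_modelExp_mem_source (Y : E) :
    ∀ᶠ t : ℝ in 𝓝 0, modelExp G (t • Y) ∈ (chartOne E G).source := by
  have h := (continuous_modelExp_smul (G := G) Y).continuousAt (x := 0)
  refine h.eventually_mem ?_
  rw [zero_smul, modelExp_zero]
  exact chartOne_source_mem_nhds

theorem tendsto_chartOne_modelExp (Y : E) :
    Tendsto (fun t : ℝ => chartOne E G (modelExp G (t • Y))) (𝓝 0) (𝓝 (chartOne E G 1)) := by
  have h := (continuous_modelExp_smul (G := G) Y).continuousAt (x := 0)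
  have h2 := (contMDiffAt_chartOne (E := E)
    (mem_of_mem_nhds (chartOne_source_mem_nhds (G := G)))).continuousAt
  rw [ContinuousAt, zero_smul, modelExp_zero] at h
  exact h2.tendsto.comp h

/-- Strictness, needed later for the open mapping argument, comes from continuity at `0` of the
derivative given by the differential equation. -/
theorem hasStrictDerivAt_chartOne_modelExp (Y : E) :
    HasStrictDerivAt (fun t : ℝ => chartOne E G (modelExp G (t • Y))) Y 0 := by
  have h1 : ∀ᶠ t : ℝ in 𝓝 0, HasDerivAt (fun t : ℝ => chartOne E G (modelExp G (t • Y)))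
      (fderiv ℝ (chartMul G (chartOne E G (modelExp G (t • Y)))) (chartOne E G 1) Y) t := by
    filter_upwards [eventually_modelExp_mem_source (G := G) Y] with t ht
      using hasDerivAt_chartOne_modelExp Y ht
  have hc : ContinuousAt (fun x => fderiv ℝ (chartMul G x) (chartOne E G 1) Y) (chartOne E G 1) :=
    (contDiffAt_fderiv_chartMul (G := G) chartOne_one_mem_target).continuousAt.clm_apply
      continuousAt_const
  have h0 : chartOne E G (modelExp G ((0 : ℝ) • Y)) = chartOne E G 1 := by
    rw [zero_smul, modelExp_zero]
  have h2 : ContinuousAt (fun t : ℝ => fderiv ℝ (chartMul G (chartOne E G (modelExp G (t • Y))))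
      (chartOne E G 1) Y) 0 := by
    rw [ContinuousAt, h0]
    exact hc.tendsto.comp (tendsto_chartOne_modelExp Y)
  have h3 := hasStrictDerivAt_of_hasDerivAt_of_continuousAt h1 h2
  rwa [h0, fderiv_chartMul_one] at h3

-- Differentiates `g y = (g y g⁻¹) g` in `y` at the identity.
omit [CompleteSpace E] [T2Space G] in
theorem fderiv_chartMul_eq_adjointAction {g : G} (hg : g ∈ (chartOne E G).source)
    [IsTopologicalGroup G] (v : E) :
    fderiv ℝ (chartMul G (chartOne E G g)) (chartOne E G 1) v
      = fderiv ℝ (fun y => chartMul G y (chartOne E G g)) (chartOne E G 1)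
        (adjointAction E g v) := by
  have h : chartMul G (chartOne E G g) =ᶠ[𝓝 (chartOne E G 1)]
      (fun y => chartMul G y (chartOne E G g)) ∘ chartConj g := by
    filter_upwards [(continuousAt_conj_chartOne_symm g).eventually_mem
      (chartOne_source_mem_nhds (E := E))] with x hx
    simp only [chartConj, Function.comp_apply, chartMul]
    rw [(chartOne E G).left_inv hx, (chartOne E G).left_inv hg]
    simp
  have h1 : HasFDerivAt (fun y => chartMul G y (chartOne E G g)) _ (chartOne E G 1) :=
    ((ContDiffAt.comp (g := fun p : E × E => chartMul G p.1 p.2)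
      (f := fun y : E => (y, chartOne E G g)) (chartOne E G 1)
      (contDiffAt_chartMul_left ((chartOne E G).map_source hg))
      (contDiffAt_id.prodMk contDiffAt_const)).differentiableAt (by simp)).hasFDerivAt
  have h1' := h1
  rw [← chartConj_chartOne_one g] at h1'
  have h2 := (h1'.comp _ (hasStrictFDerivAt_chartConj (E := E) g).hasFDerivAt)
  rw [chartConj_chartOne_one] at h2
  rw [(h2.congr_of_eventuallyEq h).fderiv]
  rfl

/-- The derivative of the adjoint action is the bracket. -/
theorem hasDerivAt_adjointAction_modelExp [IsTopologicalGroup G] (Y v : E) :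
    HasDerivAt (fun t : ℝ => adjointAction E (modelExp G (t • Y)) v) (modelBracket G Y v) 0 := by
  set x : ℝ → E := fun t => chartOne E G (modelExp G (t • Y)) with hx
  set e := chartOne E G 1 with he
  have hx0 : x 0 = e := by simp only [hx, zero_smul, modelExp_zero, he]
  have hxd : HasDerivAt x Y 0 := (hasStrictDerivAt_chartOne_modelExp Y).hasDerivAt
  set L : E → E →L[ℝ] E := fun z => fderiv ℝ (chartMul G z) e with hL
  set R : E → E →L[ℝ] E := fun z => fderiv ℝ (fun y => chartMul G y z) e with hR
  have hLd : HasFDerivAt L (fderiv ℝ L e) (x 0) := by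
    rw [hx0]
    exact ((contDiffAt_fderiv_chartMul chartOne_one_mem_target).differentiableAt
      (by simp)).hasFDerivAt
  have hRd : HasFDerivAt R (fderiv ℝ R e) (x 0) := by
    rw [hx0]
    exact ((contDiffAt_fderiv_chartMul_swap chartOne_one_mem_target).differentiableAt
      (by simp)).hasFDerivAt
  have hRe : R e = ContinuousLinearMap.id ℝ E := fderiv_chartMul_swap_one
  have hLe : L e = ContinuousLinearMap.id ℝ E := fderiv_chartMul_one
  -- From `L v = R (Ad v)` one gets `Ad v - v = R⁻¹ (L - R) v`. As `R⁻¹` tends to the identity, the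
  -- difference quotients of `Ad v` have the same limit as those of `(L - R) v`.
  have hq : HasDerivAt (fun t => L (x t) v - R (x t) v) (modelBracket G Y v) 0 := by
    have h1 := (hLd.comp_hasDerivAt 0 hxd).clm_apply (hasDerivAt_const (0 : ℝ) v)
    have h2 := (hRd.comp_hasDerivAt 0 hxd).clm_apply (hasDerivAt_const (0 : ℝ) v)
    convert! h1.sub h2 using 1
    rw [modelBracket_eq]
    simp [hL, hR, he]
  rw [hasDerivAt_iff_tendsto_slope_zero] at hq ⊢
  have hRt : Tendsto (fun t => R (x t)) (𝓝[≠] 0) (𝓝 (R e)) := by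
    have h1 : ContinuousAt (fun t => R (x t)) 0 := hRd.continuousAt.comp hxd.continuousAt
    have := h1.tendsto
    rw [hx0] at this
    exact this.mono_left nhdsWithin_le_nhds
  have hRe' : R e = (ContinuousLinearEquiv.refl ℝ E : E →L[ℝ] E) := hRe
  have hinv : ContinuousAt (ContinuousLinearMap.inverse : (E →L[ℝ] E) → (E →L[ℝ] E)) (R e) := by
    rw [hRe']
    exact (contDiffAt_map_inverse (n := 1) (ContinuousLinearEquiv.refl ℝ E)).continuousAt
  have h1 :=
    (isBoundedBilinearMap_apply (𝕜 := ℝ) (E := E) (F := E)).continuous.continuousAt.tendsto.comp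
    ((hinv.tendsto.comp hRt).prodMk_nhds hq)
  rw [hRe] at h1
  simp only [ContinuousLinearMap.inverse_id, ContinuousLinearMap.id_apply] at h1
  refine h1.congr' ?_
  have h2 : ∀ᶠ t in 𝓝[≠] (0 : ℝ), R (x t) ∈ range
      ((↑) : (E ≃L[ℝ] E) → (E →L[ℝ] E)) := by
    refine hRt.eventually_mem ?_
    rw [hRe']
    exact ContinuousLinearEquiv.nhds _
  filter_upwards [h2, (eventually_modelExp_mem_source (G := G) Y).filter_mono nhdsWithin_le_nhds]
    with t ht hts
  obtain ⟨A, hA⟩ := ht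
  have h3 : L (x t) v = R (x t) (adjointAction E (modelExp G (t • Y)) v) :=
    fderiv_chartMul_eq_adjointAction hts v
  simp only [Function.comp_apply, zero_add, hx0, hLe, hRe, sub_self, sub_zero, zero_smul,
    modelExp_zero, adjointAction_one, ContinuousLinearMap.id_apply]
  rw [h3, ← map_sub, ← map_smul, ← hA, ContinuousLinearMap.inverse_equiv]
  simp

end OneParameter

/-! ### Continuity of the exponential map. -/

section ContinuityOfExp

open Filter VectorField

variable {E : Type*} [NormedAddCommGroup E] [NormedSpace ℝ E]
  {G : Type*} [TopologicalSpace G] [ChartedSpace E G] [Group G] [LieGroup 𝓘(ℝ, E) ∞ G]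

theorem hasMFDerivAt_chartOne_symm_mulInvariantVectorField {x : E}
    (hx : x ∈ (chartOne E G).target) {ξ : ℝ → E} {t : ℝ} (hξt : ξ t = x) (Z : E)
    (hξ : HasDerivAt ξ (fderiv ℝ (chartMul G x) (chartOne E G 1) Z) t) :
    HasMFDerivAt 𝓘(ℝ, ℝ) 𝓘(ℝ, E) (fun t => (chartOne E G).symm (ξ t)) t
      ((1 : ℝ →L[ℝ] ℝ).smulRight (mulInvariantVectorField (Z : GroupLieAlgebra 𝓘(ℝ, E) G)
        ((chartOne E G).symm (ξ t)))) := by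
  subst hξt
  have : IsManifold 𝓘(ℝ, E) 1 G := inferInstance
  have h1 := mfderiv_chartOne_mulInvariantVectorField (Z : GroupLieAlgebra 𝓘(ℝ, E) G)
    ((chartOne E G).map_target hx)
  rw [(chartOne E G).right_inv hx] at h1
  have h2 : HasMFDerivAt 𝓘(ℝ, E) 𝓘(ℝ, E) (chartOne E G).symm (ξ t)
      (mfderivWithin 𝓘(ℝ, E) 𝓘(ℝ, E) (chartOne E G).symm (range 𝓘(ℝ, E)) (ξ t)) := by
    have h := ((contMDiffAt_chartOne_symm (G := G) hx).mdifferentiableAt (by simp)).hasMFDerivAt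
    rw [← mfderivWithin_univ] at h
    have h3 : range 𝓘(ℝ, E) = univ := by simp
    rwa [h3]
  have h3 := HasMFDerivAt.comp t h2 (hasMFDerivAt_iff_hasFDerivAt.mpr hξ.hasFDerivAt)
  refine h3.congr_mfderiv ?_
  have h5 := congrArg
    (fun L : E →L[ℝ] E => L (mulInvariantVectorField (I := 𝓘(ℝ, E)) (G := G) Z
      ((chartOne E G).symm (ξ t))))
    (mfderivWithin_extChartAt_symm_comp_mfderiv_extChartAt (I := 𝓘(ℝ, E)) (x := (1 : G)) hx)
  have h6 : (mfderivWithin 𝓘(ℝ, E) 𝓘(ℝ, E) (chartOne E G).symm (range 𝓘(ℝ, E)) (ξ t) : E →L[ℝ] E)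
      (fderiv ℝ (chartMul G (ξ t)) (chartOne E G 1) Z)
      = mulInvariantVectorField (Z : GroupLieAlgebra 𝓘(ℝ, E) G) ((chartOne E G).symm (ξ t)) :=
    (congrArg (mfderivWithin 𝓘(ℝ, E) 𝓘(ℝ, E) (chartOne E G).symm (range 𝓘(ℝ, E)) (ξ t) :
      E →L[ℝ] E) h1).symm.trans h5
  have key : ∀ (L : E →L[ℝ] E) (w z : E), L w = z →
      L.comp (ContinuousLinearMap.toSpanSingleton ℝ w)
        = (1 : ℝ →L[ℝ] ℝ).smulRight z := by
    rintro L w _ rfl; ext; simp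
  exact key _ _ _ h6

variable [CompleteSpace E] [T2Space G]

/-- The vector `Y` is made part of the state, with zero velocity. Dependence on the parameter then
becomes dependence on the initial condition, which Picard–Lindelöf controls for short times. -/
theorem exists_continuousAt_modelExp_smul (Z : E) :
    ∃ δ > 0, ∀ t : ℝ, |t| < δ → ContinuousAt (fun Y : E => modelExp G (t • Y)) Z := by
  set e := chartOne E G 1 with he
  have hF : ContDiffAt ℝ 1 (fun p : E × E => (fderiv ℝ (chartMul G p.1) e p.2, (0 : E))) (e, Z) :=
    (ContDiffAt.clm_apply ((contDiffAt_fderiv_chartMul (G := G) chartOne_one_mem_target).comp (e, Z)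
      contDiffAt_fst) contDiffAt_snd).prodMk contDiffAt_const
  obtain ⟨ε, hε, a, r, K, K', hr, hpl⟩ := IsPicardLindelof.of_contDiffAt_one hF
  obtain ⟨α, hα, hαc⟩ := (hpl 0).exists_forall_mem_closedBall_eq_hasDerivWithinAt_continuousOn
  have hmem : Metric.closedBall (e, Z) (r : ℝ) ×ˢ Icc (0 - ε) (0 + ε) ∈ 𝓝 ((e, Z), (0 : ℝ)) :=
    prod_mem_nhds (Metric.closedBall_mem_nhds _ hr) (Icc_mem_nhds (by linarith) (by linarith))
  have hα0 : α ((e, Z), 0) = (e, Z) := (hα _ (Metric.mem_closedBall_self hr.le)).1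
  have h1 : ∀ᶠ q in 𝓝 ((e, Z), (0 : ℝ)), (α q).1 ∈ (chartOne E G).target := by
    have hc : ContinuousAt α ((e, Z), 0) := hαc.continuousAt hmem
    refine (continuous_fst.continuousAt.comp hc).eventually_mem ?_
    simp only [Function.comp_apply, hα0]
    exact chartOne_target_mem_nhds
  obtain ⟨ρ, hρ, hball⟩ := Metric.eventually_nhds_iff_ball.mp h1
  refine ⟨min ρ ε, lt_min hρ hε, ?_⟩
  have key : ∀ Y ∈ Metric.ball Z (min ρ r), ∀ t ∈ Ioo (-(min ρ ε)) (min ρ ε),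
      modelExp G (t • Y) = (chartOne E G).symm (α ((e, Y), t)).1 := by
    intro Y hY
    have hYr : (e, Y) ∈ Metric.closedBall (e, Z) (r : ℝ) := by
      rw [Metric.mem_closedBall, Prod.dist_eq]
      simp only [dist_self]
      exact max_le hr.le ((Metric.mem_ball.mp hY).le.trans (min_le_right _ _))
    have hd : ∀ t ∈ Ioo (-(min ρ ε)) (min ρ ε), HasDerivAt (fun t => α ((e, Y), t))
        (fderiv ℝ (chartMul G (α ((e, Y), t)).1) e (α ((e, Y), t)).2, 0) t := by
      intro t ht
      have h1 : -ε < t := by have := min_le_right ρ ε; linarith [ht.1]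
      have h2 : t < ε := by have := min_le_right ρ ε; linarith [ht.2]
      exact ((hα _ hYr).2 t ⟨by linarith, by linarith⟩).hasDerivAt
        (Icc_mem_nhds (by linarith) (by linarith))
    have h0 : (0 : ℝ) ∈ Ioo (-(min ρ ε)) (min ρ ε) := by
      have := lt_min hρ hε; constructor <;> linarith
    have hsnd : ∀ t ∈ Ioo (-(min ρ ε)) (min ρ ε), (α ((e, Y), t)).2 = Y := by
      intro t ht
      have h2 : ∀ s ∈ Ioo (-(min ρ ε)) (min ρ ε),
          HasDerivAt (fun t => (α ((e, Y), t)).2) 0 s := fun s hs =>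
        (hasFDerivAt_snd (𝕜 := ℝ) (E := E) (F := E)).comp_hasDerivAt s (hd s hs)
      have h3 := isOpen_Ioo.is_const_of_deriv_eq_zero isPreconnected_Ioo
        (fun s hs => (h2 s hs).differentiableAt.differentiableWithinAt)
        (fun s hs => (h2 s hs).deriv) ht h0
      rw [h3, (hα _ hYr).1]
    have htar : ∀ t ∈ Ioo (-(min ρ ε)) (min ρ ε), (α ((e, Y), t)).1 ∈ (chartOne E G).target := by
      intro t ht
      apply hball
      rw [Metric.mem_ball, Prod.dist_eq, Prod.dist_eq]
      simp only [dist_self, Real.dist_eq, sub_zero]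
      refine max_lt (max_lt hρ ((Metric.mem_ball.mp hY).trans_le (min_le_left _ _))) ?_
      exact (abs_lt.mpr ht).trans_le (min_le_left _ _)
    have hint : IsMIntegralCurveOn (I := 𝓘(ℝ, E)) (fun t => (chartOne E G).symm (α ((e, Y), t)).1)
        (mulInvariantVectorField (Y : GroupLieAlgebra 𝓘(ℝ, E) G))
        (Ioo (-(min ρ ε)) (min ρ ε)) := by
      intro t ht
      have h2 := (hasFDerivAt_fst (𝕜 := ℝ) (E := E) (F := E)).comp_hasDerivAt t (hd t ht)
      rw [hsnd t ht] at h2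
      exact (hasMFDerivAt_chartOne_symm_mulInvariantVectorField (htar t ht)
        (ξ := fun t => (α ((e, Y), t)).1) rfl Y h2).hasMFDerivWithinAt
    have : IsManifold 𝓘(ℝ, E) 1 G := inferInstance
    have h3 := isMIntegralCurveOn_Ioo_eqOn_of_contMDiff_boundaryless h0
      (contMDiff_one_mulInvariantVectorField (E := E) (G := G) Y)
      ((isOneParameterSubgroup_modelExp (G := G) Y).2.isMIntegralCurveOn _) hint (by
        have hα1 : α ((e, Y), 0) = (e, Y) := (hα _ hYr).1
        simp only [zero_smul, modelExp_zero, hα1]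
        exact chartOne_symm_one.symm)
    exact fun t ht => h3 ht
  intro t ht
  have ht' := abs_lt.mp ht
  have hZ : Metric.ball Z (min ρ (r : ℝ)) ∈ 𝓝 Z := Metric.ball_mem_nhds _ (lt_min hρ hr)
  have heq : (fun Y : E => modelExp G (t • Y)) =ᶠ[𝓝 Z]
      fun Y => (chartOne E G).symm (α ((e, Y), t)).1 := by
    filter_upwards [hZ] with Y hY using key Y hY t ht'
  refine ContinuousAt.congr ?_ heq.symm
  have htar : (α ((e, Z), t)).1 ∈ (chartOne E G).target := by
    apply hball
    rw [Metric.mem_ball, Prod.dist_eq]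
    simp only [dist_self, Real.dist_eq, sub_zero]
    exact max_lt hρ (ht.trans_le (min_le_left _ _))
  have hc1 : ContinuousAt α ((e, Z), t) := by
    refine hαc.continuousAt (prod_mem_nhds (Metric.closedBall_mem_nhds _ hr) (Icc_mem_nhds ?_ ?_))
    · have := min_le_right ρ ε; linarith [ht'.1]
    · have := min_le_right ρ ε; linarith [ht'.2]
  have hc2 : ContinuousAt (fun Y : E => ((e, Y), t)) Z := by fun_prop
  have hc3 : ContinuousAt (fun Y : E => (α ((e, Y), t)).1) Z :=
    continuous_fst.continuousAt.comp (ContinuousAt.comp (f := fun Y : E => ((e, Y), t)) hc1 hc2)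
  exact ContinuousAt.comp (f := fun Y : E => (α ((e, Y), t)).1)
    (contMDiffAt_chartOne_symm htar).continuousAt hc3

theorem modelExp_nsmul (m : ℕ) (Y : E) : modelExp G ((m : ℝ) • Y) = modelExp G Y ^ m := by
  induction m with
  | zero => simp [modelExp_zero]
  | succ k ih => rw [Nat.cast_succ, modelExp_add_smul, ih, one_smul, pow_succ]

/-- Short-time continuity suffices because `exp Y` is the `m`-th power of `exp (Y / m)`. -/
theorem continuous_modelExp [IsTopologicalGroup G] : Continuous (modelExp G : E → G) := by
  rw [continuous_iff_continuousAt]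
  intro Z
  obtain ⟨δ, hδ, h⟩ := exists_continuousAt_modelExp_smul (G := G) Z
  obtain ⟨m, hm⟩ := exists_nat_one_div_lt hδ
  have h1 := (h (1 / (m + 1 : ℝ)) (by rwa [abs_of_pos (by positivity)])).pow (m + 1)
  have h2 : ∀ Y : E, modelExp G Y = modelExp G ((1 / (m + 1 : ℝ)) • Y) ^ (m + 1) := by
    intro Y
    rw [← modelExp_nsmul, smul_smul]
    congr 1
    push_cast
    rw [mul_one_div_cancel (by positivity), one_smul]
  exact h1.congr (Eventually.of_forall fun Y => (h2 Y).symm)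

end ContinuityOfExp

/-! ### Tangent families and the accessibility theorem. -/

section Accessibility

open Filter VectorField

variable {E : Type*} [NormedAddCommGroup E] [NormedSpace ℝ E]
  {G : Type*} [TopologicalSpace G] [ChartedSpace E G] [Group G] [LieGroup 𝓘(ℝ, E) ∞ G]

theorem hasStrictFDerivAt_chartMul_one :
    HasStrictFDerivAt (fun p : E × E => chartMul G p.1 p.2)
      (ContinuousLinearMap.fst ℝ E E + ContinuousLinearMap.snd ℝ E E)
      (chartOne E G 1, chartOne E G 1) := by
  have h := (contDiffAt_chartMul_right (E := E) (G := G)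
    chartOne_one_mem_target).hasStrictFDerivAt (by simp)
  convert! h using 1
  have h1 := fderiv_chartMul_eq (E := E) (G := G) chartOne_one_mem_target
  have h2 := fderiv_chartMul_swap_eq (E := E) (G := G) chartOne_one_mem_target
  rw [fderiv_chartMul_one] at h1
  rw [fderiv_chartMul_swap_one] at h2
  refine ContinuousLinearMap.ext fun p => ?_
  have h3 := congrArg (fun L : E →L[ℝ] E => L p.2) h1
  have h4 := congrArg (fun L : E →L[ℝ] E => L p.1) h2
  simp only [ContinuousLinearMap.id_apply, ContinuousLinearMap.comp_apply,
    ContinuousLinearMap.inl_apply, ContinuousLinearMap.inr_apply] at h3 h4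
  simp only [add_apply, ContinuousLinearMap.coe_fst',
    ContinuousLinearMap.coe_snd']
  conv_lhs => rw [h3, h4]
  rw [← map_add]
  simp

theorem HasDerivAt.mem_submodule_of_eventually_mem [FiniteDimensional ℝ E] {H : Submodule ℝ E}
    {f : ℝ → E} {f' : E} (hf : HasDerivAt f f' 0) (h0 : f 0 ∈ H)
    (h : ∀ᶠ t in 𝓝[>] (0 : ℝ), f t ∈ H) : f' ∈ H := by
  have hf' : Tendsto (slope f 0) (𝓝[>] 0) (𝓝 f') :=
    (hasDerivAt_iff_tendsto_slope.mp hf).mono_left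
      (nhdsWithin_mono 0 (fun t (ht : 0 < t) => ht.ne'))
  refine H.closed_of_finiteDimensional.mem_of_tendsto hf' ?_
  filter_upwards [h] with t ht
  exact H.smul_mem _ (H.sub_mem ht h0)

variable [CompleteSpace E] [T2Space G]

variable (G) in
/-- The set `M` contains a family of elements of `G`, strictly differentiable at a parameter where
it passes through `g`, whose velocities there, left translated to the identity, fill `H`. -/
def HasTangentFamily (M : Set G) (g : G) (H : Submodule ℝ E) : Prop :=
  ∃ (P : Type) (_ : NormedAddCommGroup P) (_ : NormedSpace ℝ P) (_ : CompleteSpace P)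
    (Φ : P → G) (D : P →L[ℝ] E), Φ 0 = 1 ∧ ContinuousAt Φ 0 ∧
    HasStrictFDerivAt (fun p => chartOne E G (Φ p)) D 0 ∧
    (∀ᶠ p in 𝓝 0, g * Φ p ∈ M) ∧ H ≤ LinearMap.range (D : P →ₗ[ℝ] E)

omit [LieGroup 𝓘(ℝ, E) ∞ G] [CompleteSpace E] [T2Space G] in
theorem hasTangentFamily_bot {M : Set G} {g : G} (hg : g ∈ M) :
    HasTangentFamily G M g (⊥ : Submodule ℝ E) :=
  ⟨ℝ, inferInstance, inferInstance, inferInstance, fun _ => 1, 0, rfl, continuousAt_const,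
    hasStrictFDerivAt_const _ _, by simp [hg], bot_le⟩

-- A strict derivative that is onto makes the family cover a neighbourhood of `1` in the chart; left
-- translation carries it to `g`.
omit [LieGroup 𝓘(ℝ, E) ∞ G] [T2Space G] in
theorem HasTangentFamily.mem_interior [IsTopologicalGroup G] {M : Set G} {g : G}
    (h : HasTangentFamily G M g (⊤ : Submodule ℝ E)) : g ∈ interior M := by
  obtain ⟨P, _, _, _, Φ, D, hΦ0, hΦc, hΦd, hM, hD⟩ := h
  have h1 := hΦd.map_nhds_eq_of_surj (top_le_iff.mp hD)
  rw [ContinuousAt, hΦ0] at hΦc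
  rw [hΦ0] at h1
  have h2 : {p | g * Φ p ∈ M ∧ Φ p ∈ (chartOne E G).source} ∈ 𝓝 (0 : P) :=
    hM.and (hΦc.eventually_mem chartOne_source_mem_nhds)
  have h3 := image_mem_map (m := fun p => chartOne E G (Φ p)) h2
  rw [h1] at h3
  have h4 : ∀ᶠ y in 𝓝 (1 : G), g * y ∈ M := by
    filter_upwards [chartOne_source_mem_nhds (E := E) (G := G),
      (continuousAt_extChartAt (I := 𝓘(ℝ, E)) (1 : G)).eventually_mem h3] with y hy hy'
    obtain ⟨p, ⟨hpM, hps⟩, hp⟩ := hy'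
    rwa [← (chartOne E G).injOn hps hy hp]
  rw [mem_interior_iff_mem_nhds]
  have h5 : Tendsto (fun x => g⁻¹ * x) (𝓝 g) (𝓝 1) := by
    have := (continuous_const_mul g⁻¹).tendsto g
    rwa [inv_mul_cancel] at this
  filter_upwards [h5.eventually h4] with x hx
  simpa using hx

/-- The new family multiplies the old one by `u * exp ((t₀ + q) Y)`, with `q` an extra parameter.
Recentring at the new base point conjugates the old directions and adds `Y`. Since `t₀ > 0`, `q` may
take both signs. -/
theorem HasTangentFamily.mul [IsTopologicalGroup G] {M : Submonoid G} {g u : G}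
    {H : Submodule ℝ E} (h : HasTangentFamily G (M : Set G) g H) (hu : u ∈ M) {Y : E}
    (hY : ∀ t : ℝ, 0 ≤ t → modelExp G (t • Y) ∈ M) {t₀ : ℝ} (ht₀ : 0 < t₀) :
    HasTangentFamily G (M : Set G) (g * (u * modelExp G (t₀ • Y)))
      (H.map (adjointAction E (u * modelExp G (t₀ • Y))⁻¹ : E →ₗ[ℝ] E) ⊔ ℝ ∙ Y) := by
  obtain ⟨P, _, _, _, Φ, D, hΦ0, hΦc, hΦd, hM, hD⟩ := h
  set c := u * modelExp G (t₀ • Y) with hc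
  set A := adjointAction E c⁻¹ with hA
  refine ⟨P × ℝ, inferInstance, inferInstance, inferInstance,
    fun q => c⁻¹ * Φ q.1 * c⁻¹⁻¹ * modelExp G (q.2 • Y),
    (A.comp D).comp (ContinuousLinearMap.fst ℝ P ℝ) +
      (ContinuousLinearMap.toSpanSingleton ℝ Y).comp (ContinuousLinearMap.snd ℝ P ℝ),
    ?_, ?_, ?_, ?_, ?_⟩
  · simp [hΦ0, modelExp_zero]
  · have h1 : ContinuousAt (fun q : P × ℝ => Φ q.1) 0 :=
      ContinuousAt.comp (f := Prod.fst) (x := (0 : P × ℝ)) hΦc continuousAt_fst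
    have h2 : ContinuousAt (fun q : P × ℝ => modelExp G (q.2 • Y)) 0 :=
      ((continuous_modelExp_smul Y).comp continuous_snd).continuousAt
    exact ((continuousAt_const.mul h1).mul continuousAt_const).mul h2
  · have h1 : HasStrictFDerivAt (fun q : P × ℝ => chartOne E G (Φ q.1))
        (D.comp (ContinuousLinearMap.fst ℝ P ℝ)) 0 :=
      HasStrictFDerivAt.comp (f := Prod.fst) (0 : P × ℝ) hΦd hasStrictFDerivAt_fst
    have h2 : HasStrictFDerivAt (fun q : P × ℝ => chartConj c⁻¹ (chartOne E G (Φ q.1)))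
        (A.comp (D.comp (ContinuousLinearMap.fst ℝ P ℝ))) 0 := by
      refine HasStrictFDerivAt.comp (f := fun q : P × ℝ => chartOne E G (Φ q.1)) (0 : P × ℝ) ?_ h1
      simp only [Prod.fst_zero, hΦ0]
      exact hasStrictFDerivAt_chartConj _
    have h3 : HasStrictFDerivAt (fun q : P × ℝ => chartOne E G (modelExp G (q.2 • Y)))
        ((ContinuousLinearMap.toSpanSingleton ℝ Y).comp (ContinuousLinearMap.snd ℝ P ℝ)) 0 :=
      HasStrictFDerivAt.comp (f := Prod.snd) (0 : P × ℝ)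
        (hasStrictDerivAt_chartOne_modelExp Y).hasStrictFDerivAt hasStrictFDerivAt_snd
    have h4 := HasStrictFDerivAt.comp (g := fun p : E × E => chartMul G p.1 p.2)
      (f := fun q : P × ℝ => (chartConj c⁻¹ (chartOne E G (Φ q.1)),
        chartOne E G (modelExp G (q.2 • Y)))) (0 : P × ℝ)
      (g' := ContinuousLinearMap.fst ℝ E E + ContinuousLinearMap.snd ℝ E E) (by
        simp only [Prod.fst_zero, Prod.snd_zero, hΦ0, zero_smul, modelExp_zero,
          chartConj_chartOne_one]
        exact hasStrictFDerivAt_chartMul_one) (h2.prodMk h3)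
    have h5 : ∀ᶠ q : P × ℝ in 𝓝 0, chartMul G (chartConj c⁻¹ (chartOne E G (Φ q.1)))
        (chartOne E G (modelExp G (q.2 • Y)))
        = chartOne E G (c⁻¹ * Φ q.1 * c⁻¹⁻¹ * modelExp G (q.2 • Y)) := by
      have hfst : Tendsto (Prod.fst : P × ℝ → P) (𝓝 0) (𝓝 0) := continuous_fst.tendsto _
      have hsnd : Tendsto (Prod.snd : P × ℝ → ℝ) (𝓝 0) (𝓝 0) := continuous_snd.tendsto _
      rw [ContinuousAt, hΦ0] at hΦc
      have h6 : Tendsto (fun p => c⁻¹ * Φ p * c⁻¹⁻¹) (𝓝 0) (𝓝 1) := by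
        have := (hΦc.const_mul c⁻¹).mul_const c⁻¹⁻¹
        simpa using this
      filter_upwards [hfst.eventually (hΦc.eventually_mem (chartOne_source_mem_nhds (E := E))),
        hfst.eventually (h6.eventually_mem (chartOne_source_mem_nhds (E := E))),
        hsnd.eventually (eventually_modelExp_mem_source (G := G) Y)] with q hq1 hq2 hq3
      simp only [chartMul, chartConj]
      rw [(chartOne E G).left_inv hq1, (chartOne E G).left_inv hq2, (chartOne E G).left_inv hq3]
    refine (h4.congr_of_eventuallyEq h5).congr_fderiv ?_
    ext q <;> simp
  · have hfst : Tendsto (Prod.fst : P × ℝ → P) (𝓝 0) (𝓝 0) := continuous_fst.tendsto _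
    have hsnd : Tendsto (Prod.snd : P × ℝ → ℝ) (𝓝 0) (𝓝 0) := continuous_snd.tendsto _
    filter_upwards [hfst.eventually hM, hsnd.eventually (lt_mem_nhds (neg_lt_zero.mpr ht₀))]
      with q hq1 hq2
    have h1 : g * c * (c⁻¹ * Φ q.1 * c⁻¹⁻¹ * modelExp G (q.2 • Y))
        = g * Φ q.1 * (u * modelExp G ((t₀ + q.2) • Y)) := by
      rw [modelExp_add_smul, hc]; group
    rw [h1]
    exact M.mul_mem hq1 (M.mul_mem hu (hY _ (by linarith)))
  · rw [sup_le_iff]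
    constructor
    · rintro _ ⟨h, hh, rfl⟩
      obtain ⟨p, rfl⟩ := hD hh
      exact ⟨(p, 0), by simp⟩
    · rw [Submodule.span_singleton_le_iff_mem]
      exact ⟨(0, 1), by simp⟩

/-- Elements of one one-parameter subgroup commute, so conjugation fixes the curve whose velocity is
`Y`. -/
theorem adjointAction_modelExp_self (Y : E) (t : ℝ) :
    adjointAction E (modelExp G (t • Y)) Y = Y := by
  have h1 := (hasStrictDerivAt_chartOne_modelExp (G := G) Y).hasDerivAt
  have h2 : HasDerivAt (fun s : ℝ => chartConj (modelExp G (t • Y))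
      (chartOne E G (modelExp G (s • Y)))) (adjointAction E (modelExp G (t • Y)) Y) 0 := by
    have h3 : HasFDerivAt (chartConj (modelExp G (t • Y))) (adjointAction E (modelExp G (t • Y)))
        (chartOne E G (modelExp G ((0 : ℝ) • Y))) := by
      rw [zero_smul, modelExp_zero]
      exact (hasStrictFDerivAt_chartConj _).hasFDerivAt
    exact h3.comp_hasDerivAt (0 : ℝ) h1
  refine h2.unique (h1.congr_of_eventuallyEq ?_)
  filter_upwards [eventually_modelExp_mem_source (G := G) Y] with s hs
  simp only [chartConj]
  rw [(chartOne E G).left_inv hs, ← modelExp_add_smul, add_comm, modelExp_add_smul,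
    mul_inv_cancel_right]

variable (G) in
/-- The submonoid generated by the half-lines `exp (t Y)`, `t ≥ 0`, for `Y ∈ F`. -/
noncomputable def controlMonoid (F : Set E) : Submonoid G :=
  Submonoid.closure {g | ∃ Y ∈ F, ∃ t : ℝ, 0 ≤ t ∧ modelExp G (t • Y) = g}

theorem modelExp_smul_mem_controlMonoid {F : Set E} {Y : E} (hY : Y ∈ F) {t : ℝ} (ht : 0 ≤ t) :
    modelExp G (t • Y) ∈ controlMonoid G F :=
  Submonoid.subset_closure ⟨Y, hY, t, ht, rfl⟩

theorem modelExp_mem_controlMonoid {F : Set E} {Y : E} (hY : Y ∈ F) :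
    modelExp G Y ∈ controlMonoid G F := by
  simpa using modelExp_smul_mem_controlMonoid (G := G) hY zero_le_one

/-- If `F` generates the Lie algebra, the monoid generated by `exp (t Y)`, `t ≥ 0`, `Y ∈ F` has
interior points arbitrarily near the identity. -/
theorem exists_mem_interior_controlMonoid [FiniteDimensional ℝ E] [IsTopologicalGroup G]
    {F : Set E}
    (hF : ∀ K : Submodule ℝ E, F ⊆ K → (∀ Y ∈ F, ∀ v ∈ K, modelBracket G Y v ∈ K) → K = ⊤)
    {N : Set G} (hN : IsOpen N) (h1 : 1 ∈ N) :
    ∃ p ∈ N, p ∈ interior (controlMonoid G F : Set G) := by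
  classical
  set M := controlMonoid G F
  let Q : ℕ → Prop := fun d => ∃ g ∈ N, ∃ H : Submodule ℝ E,
    HasTangentFamily G (M : Set G) g H ∧ Module.finrank ℝ H = d
  have hQ0 : Q 0 := ⟨1, h1, ⊥, hasTangentFamily_bot M.one_mem, finrank_bot ℝ E⟩
  -- A pair `(g, H)` of maximal dimension among base points in `N`.
  obtain ⟨g, hg, H, hH, hd⟩ : Q (Nat.findGreatest Q (Module.finrank ℝ E)) :=
    Nat.findGreatest_spec (Nat.zero_le _) hQ0
  have hmax : ∀ g' ∈ N, ∀ H' : Submodule ℝ E, HasTangentFamily G (M : Set G) g' H' →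
      Module.finrank ℝ H' ≤ Module.finrank ℝ H := by
    intro g' hg' H' hH'
    rw [hd]
    exact Nat.le_findGreatest (Submodule.finrank_le H') ⟨g', hg', H', hH', rfl⟩
  have hev : ∀ u, g * u ∈ N → ∀ Y : E, ∀ᶠ t in 𝓝[>] (0 : ℝ),
      g * (u * modelExp G (t • Y)) ∈ N := by
    intro u hu Y
    have hc : Continuous (fun t : ℝ => g * (u * modelExp G (t • Y))) :=
      continuous_const.mul (continuous_const.mul (continuous_modelExp_smul Y))
    refine (hc.continuousAt (x := 0)).tendsto.mono_left nhdsWithin_le_nhds |>.eventually_mem ?_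
    rw [zero_smul, modelExp_zero, mul_one]
    exact hN.mem_nhds hu
  -- Asking the condition for all `u ∈ M` lets `u` be replaced by `u * exp (t Y)`, which gives
  -- stability under brackets; `g * u ∈ N` keeps base points where maximality applies.
  let K : Submodule ℝ E :=
    { carrier := {v | ∀ u ∈ M, g * u ∈ N → adjointAction E u v ∈ H}
      add_mem' := fun {a b} ha hb u hu hgu => by
        rw [map_add]; exact H.add_mem (ha u hu hgu) (hb u hu hgu)
      zero_mem' := fun u hu hgu => by rw [map_zero]; exact H.zero_mem
      smul_mem' := fun r a ha u hu hgu => by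
        rw [map_smul]; exact H.smul_mem r (ha u hu hgu) }
  have hK : K = ⊤ := by
    refine hF K ?_ ?_
    · intro Y hY u hu hgu
      obtain ⟨t, htN, ht⟩ := ((hev u hgu Y).and self_mem_nhdsWithin).exists
      have ht : 0 < t := ht
      have hT := hH.mul hu (fun t ht => modelExp_smul_mem_controlMonoid hY ht) ht
      set c := u * modelExp G (t • Y) with hc
      have hinv : ∀ v : E, adjointAction E c (adjointAction E c⁻¹ v) = v := fun v => by
        rw [← ContinuousLinearMap.comp_apply, ← adjointAction_mul, mul_inv_cancel,
          adjointAction_one, ContinuousLinearMap.id_apply]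
      have hinj : Function.Injective (adjointAction E c⁻¹ : E →ₗ[ℝ] E) :=
        Function.LeftInverse.injective (g := adjointAction E c) hinv
      have hle := hmax _ htN _ hT
      -- The conjugate of `H` already has the maximal dimension, so adjoining `Y` cannot enlarge it.
      rw [(Submodule.equivMapOfInjective _ hinj H).finrank_eq] at hle
      have hYmem : Y ∈ H.map (adjointAction E c⁻¹ : E →ₗ[ℝ] E) := by
        rw [Submodule.eq_of_le_of_finrank_le le_sup_left hle]
        exact Submodule.mem_sup_right (Submodule.mem_span_singleton_self Y)
      obtain ⟨h, hh, hhY⟩ := hYmem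
      have hcY : adjointAction E c Y = h := by
        rw [← hhY]; exact hinv h
      have huY : adjointAction E c Y = adjointAction E u Y := by
        rw [hc, adjointAction_mul, ContinuousLinearMap.comp_apply, adjointAction_modelExp_self]
      rwa [← huY, hcY]
    · intro Y hY v hv u hu hgu
      -- Only `t > 0` stays in `M`, but the one-sided difference quotients lie in the closed
      -- subspace `H`, hence so does their limit `Ad_u [Y, v]`.
      have hd := (adjointAction E u).hasFDerivAt.comp_hasDerivAt (0 : ℝ)
        (hasDerivAt_adjointAction_modelExp (G := G) Y v)
      refine hd.mem_submodule_of_eventually_mem ?_ ?_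
      · simpa [modelExp_zero, adjointAction_one] using hv u hu hgu
      · filter_upwards [hev u hgu Y, self_mem_nhdsWithin] with t htN ht
        have h2 := hv _ (M.mul_mem hu (modelExp_smul_mem_controlMonoid hY (le_of_lt ht))) htN
        rwa [adjointAction_mul] at h2
  have hHtop : H = ⊤ := by
    rw [eq_top_iff]
    intro v _
    have hv : v ∈ K := hK ▸ Submodule.mem_top
    have := hv 1 M.one_mem (by rwa [mul_one])
    rwa [adjointAction_one] at this
  subst hHtop
  exact ⟨g, hg, hH.mem_interior⟩

end Accessibility

/-! ### Bracket generation in a stratified Lie algebra. -/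

/-- A subspace which contains a set spanning the first layer of a stratification and is stable
under the bracket with the elements of that set is everything. -/
theorem LieStratification.eq_top_of_lie_mem {L : Type*} [LieRing L] [LieAlgebra ℝ L] {s : ℕ}
    (V : LieStratification L s) {F : Set L} (hF : V.layer 1 ≤ Submodule.span ℝ F)
    {K : Submodule ℝ L} (hFK : F ⊆ K) (hK : ∀ Y ∈ F, ∀ v ∈ K, ⁅Y, v⁆ ∈ K) : K = ⊤ := by
  have h1 : V.layer 1 ≤ K := hF.trans (Submodule.span_le.mpr hFK)
  have h2 : ∀ x ∈ Submodule.span ℝ F, ∀ v ∈ K, ⁅x, v⁆ ∈ K := by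
    intro x hx v hv
    induction hx using Submodule.span_induction with
    | mem x hx => exact hK x hx v hv
    | zero => rw [zero_lie]; exact K.zero_mem
    | add x y _ _ hx hy => rw [add_lie]; exact K.add_mem hx hy
    | smul a x _ hx => rw [smul_lie]; exact K.smul_mem a hx
  have h3 : ∀ i, V.layer (i + 1) ≤ K := by
    intro i
    induction i with
    | zero => exact h1
    | succ i ih =>
      rcases lt_or_ge (i + 1) s with hi | hi
      · rw [← V.span_lie (i + 1) (by omega) hi, Submodule.span_le]
        rintro _ ⟨x, hx, y, hy, rfl⟩
        exact h2 x (hF hx) y (ih hy)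
      · rw [V.layer_of_gt _ (by omega)]; exact bot_le
  rw [eq_top_iff, ← V.isInternal.submodule_iSup_eq_top, iSup_le_iff]
  rintro (_ | i)
  · rw [V.layer_zero]; exact bot_le
  · exact h3 i

/-! ### Half-spaces and spanning sets inside them. -/

section HalfSpace

variable {W : Type*} [AddCommGroup W] [Module ℝ W] {B : LinearMap.BilinForm ℝ W}

theorem mem_normalHalfSpace_iff {ν : W} (hν : ν ∈ bilinUnitSphere B) {Y : W} :
    Y ∈ normalHalfSpace B ν ↔ 0 ≤ B ν Y := by
  have hν : B ν ν = 1 := hν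
  constructor
  · rintro ⟨Z, hZ, t, ht, rfl⟩
    simpa [hZ, hν] using ht
  · intro h
    exact ⟨Y - B ν Y • ν, by simp [hν], B ν Y, h, by simp⟩

theorem exists_finite_span_eq_top_of_pos [Module.Finite ℝ W] {ν : W}
    (hν : ν ∈ bilinUnitSphere B) :
    ∃ F : Set W, F.Finite ∧ (∀ Y ∈ F, 0 < B ν Y) ∧ Submodule.span ℝ F = ⊤ := by
  have hν : B ν ν = 1 := hν
  obtain ⟨T, hT⟩ := Module.Finite.fg_top (R := ℝ) (M := W)
  -- The multiple of `ν` makes the pairing with `ν` at least `1`; including `ν` allows the shift to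
  -- be undone in the span.
  refine ⟨insert ν ((fun Z => Z + (1 + |B ν Z|) • ν) '' (T : Set W)),
    (T.finite_toSet.image _).insert ν, ?_, ?_⟩
  · rintro _ (rfl | ⟨Z, _, rfl⟩)
    · rw [hν]; exact one_pos
    · simp only [map_add, map_smul, hν, smul_eq_mul, mul_one]
      linarith [neg_abs_le (B ν Z)]
  · rw [eq_top_iff, ← hT, Submodule.span_le]
    intro Z hZ
    have h1 : ν ∈ Submodule.span ℝ (insert ν ((fun Z => Z + (1 + |B ν Z|) • ν) '' (T : Set W))) :=
      Submodule.subset_span (mem_insert _ _)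
    have h2 : Z + (1 + |B ν Z|) • ν ∈
        Submodule.span ℝ (insert ν ((fun Z => Z + (1 + |B ν Z|) • ν) '' (T : Set W))) :=
      Submodule.subset_span (mem_insert_of_mem _ ⟨Z, hZ, rfl⟩)
    have h3 := Submodule.sub_mem _ h2 (Submodule.smul_mem _ (1 + |B ν Z|) h1)
    simpa using h3

end HalfSpace

/-! ### Finitely generated monoids inside the semigroups `S_μ`. -/

section Semigroup

open Filter VectorField

variable {E : Type*} [NormedAddCommGroup E] [NormedSpace ℝ E] [CompleteSpace E]
  {G : Type*} [TopologicalSpace G] [T2Space G] [ChartedSpace E G] [Group G] [LieGroup 𝓘(ℝ, E) ∞ G]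
  {W : Submodule ℝ (GroupLieAlgebra 𝓘(ℝ, E) G)} {B : LinearMap.BilinForm ℝ W}

/-- The monoid generated by the half-lines `exp (t Y)`, `t ≥ 0`, `Y ∈ F`, for `F ⊆ W`. -/
noncomputable def horizontalMonoid (F : Set W) : Submonoid G :=
  controlMonoid G (E := E) ((fun Y : W => (Y : GroupLieAlgebra 𝓘(ℝ, E) G)) '' F)

theorem horizontalMonoid_mono {F F' : Set W} (h : F ⊆ F') :
    horizontalMonoid F ≤ horizontalMonoid F' := by
  refine Submonoid.closure_mono ?_
  rintro _ ⟨Y, hY, t, ht, rfl⟩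
  exact ⟨Y, image_mono h hY, t, ht, rfl⟩

theorem lieExp_mem_horizontalMonoid {F : Set W} {Y : W} (hY : Y ∈ F) :
    lieExp (Y : GroupLieAlgebra 𝓘(ℝ, E) G) ∈ horizontalMonoid F :=
  modelExp_mem_controlMonoid (E := E) (mem_image_of_mem _ hY)

theorem horizontalMonoid_subset_semigroupOfNormal {F : Set W} {μ : W}
    (hμ : μ ∈ bilinUnitSphere B) (hF : ∀ Y ∈ F, 0 ≤ B μ Y) :
    (horizontalMonoid F : Set G) ⊆ semigroupOfNormal B μ := by
  have hexp : ∀ Y : W, 0 ≤ B μ Y →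
      lieExp (Y : GroupLieAlgebra 𝓘(ℝ, E) G) ∈ semigroupOfNormal B μ := fun Y hY =>
    Subsemigroup.subset_closure ⟨Y, (mem_normalHalfSpace_iff hμ).mpr hY, rfl⟩
  intro g hg
  induction hg using Submonoid.closure_induction with
  | mem g hg =>
    obtain ⟨_, ⟨Y, hY, rfl⟩, t, ht, rfl⟩ := hg
    exact hexp (t • Y) (by rw [map_smul]; exact mul_nonneg ht (hF Y hY))
  | one =>
    -- The semigroup contains the identity, as `0` lies in the closed half-space.
    have h0 := hexp 0 (by rw [map_zero])
    have h1 : lieExp ((0 : W) : GroupLieAlgebra 𝓘(ℝ, E) G) = 1 := modelExp_zero (E := E) (G := G)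
    rwa [h1] at h0
  | mul x y _ _ hx hy => exact Subsemigroup.mul_mem _ hx hy

/-- A generator `exp Z` is the limit of `exp (Z + ε ν)` as `ε → 0+`, with exponents in the open
half-space; continuity of multiplication extends this to products. -/
theorem exists_horizontalMonoid_mem_of_mem_semigroupOfNormal [IsTopologicalGroup G] {ν : W}
    (hν : ν ∈ bilinUnitSphere B) {h : G} (hh : h ∈ semigroupOfNormal B ν) :
    ∀ O ∈ 𝓝 h, ∃ F : Set W, F.Finite ∧ (∀ Y ∈ F, 0 < B ν Y) ∧
      ∃ h' ∈ O, h' ∈ horizontalMonoid F := by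
  induction hh using Subsemigroup.closure_induction with
  | mem g hg =>
    obtain ⟨Z, hZ, rfl⟩ := hg
    rw [mem_normalHalfSpace_iff hν] at hZ
    intro O hO
    have hc : Continuous (fun ε : ℝ => lieExp ((Z + ε • ν : W) : GroupLieAlgebra 𝓘(ℝ, E) G)) := by
      have h1 : Continuous (fun ε : ℝ => (show E from (Z : GroupLieAlgebra 𝓘(ℝ, E) G)) +
          ε • (show E from (ν : GroupLieAlgebra 𝓘(ℝ, E) G))) := by fun_prop
      exact (continuous_modelExp (E := E) (G := G)).comp h1
    have h1 : ∀ᶠ ε in 𝓝[>] (0 : ℝ),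
        lieExp ((Z + ε • ν : W) : GroupLieAlgebra 𝓘(ℝ, E) G) ∈ O := by
      refine ((hc.tendsto 0).mono_left nhdsWithin_le_nhds).eventually_mem ?_
      simpa using hO
    obtain ⟨ε, hεO, hε⟩ := (h1.and self_mem_nhdsWithin).exists
    have hε : 0 < ε := hε
    refine ⟨{Z + ε • ν}, finite_singleton _, ?_, _, hεO, lieExp_mem_horizontalMonoid rfl⟩
    rintro _ rfl
    have hν' : B ν ν = 1 := hν
    simp only [map_add, map_smul, hν', smul_eq_mul, mul_one]
    linarith
  | mul x y _ _ hx hy =>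
    intro O hO
    have h1 := (continuous_mul (M := G)).continuousAt (x := (x, y)) hO
    rw [mem_map, mem_nhds_prod_iff] at h1
    obtain ⟨Ox, hOx, Oy, hOy, hsub⟩ := h1
    obtain ⟨F₁, hF₁, hp₁, x', hx', hm₁⟩ := hx Ox hOx
    obtain ⟨F₂, hF₂, hp₂, y', hy', hm₂⟩ := hy Oy hOy
    refine ⟨F₁ ∪ F₂, hF₁.union hF₂, ?_, x' * y', hsub (mk_mem_prod hx' hy'), ?_⟩
    · rintro Y (hY | hY)
      exacts [hp₁ Y hY, hp₂ Y hY]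
    · exact mul_mem (horizontalMonoid_mono subset_union_left hm₁)
        (horizontalMonoid_mono subset_union_right hm₂)

omit [CompleteSpace E] [T2Space G] [LieGroup 𝓘(ℝ, E) ∞ G] in
theorem isOpen_setOf_pos_of_finite [FiniteDimensional ℝ E] {F : Set W} (hF : F.Finite) :
    IsOpen {μ : bilinUnitSphere B | ∀ Y ∈ F, 0 < B μ Y} := by
  have : FiniteDimensional ℝ (GroupLieAlgebra 𝓘(ℝ, E) G) :=
    inferInstanceAs (FiniteDimensional ℝ E)
  have : T2Space (GroupLieAlgebra 𝓘(ℝ, E) G) := inferInstanceAs (T2Space E)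
  simp only [ofPred_forall]
  refine hF.isOpen_biInter fun Y _ => ?_
  have hc : Continuous (B.flip Y) := LinearMap.continuous_of_finiteDimensional _
  exact isOpen_lt continuous_const (hc.comp continuous_subtype_val)

theorem subset_interior_iInter_semigroupOfNormal [FiniteDimensional ℝ E] {ν : bilinUnitSphere B}
    {F : Set W} (hF : F.Finite) (hpos : ∀ Y ∈ F, 0 < B ν Y) :
    ∃ U : Set (bilinUnitSphere B), IsOpen U ∧ ν ∈ U ∧
      interior (horizontalMonoid F : Set G) ⊆
        interior (⋂ μ ∈ U, semigroupOfNormal B (μ : W)) := by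
  refine ⟨_, isOpen_setOf_pos_of_finite hF, hpos, interior_mono (subset_iInter₂ fun μ hμ => ?_)⟩
  exact horizontalMonoid_subset_semigroupOfNormal μ.2 fun Y hY => (hμ Y hY).le

theorem exists_mem_interior_horizontalMonoid [FiniteDimensional ℝ E] [IsTopologicalGroup G] {s : ℕ}
    (V : LieStratification (GroupLieAlgebra 𝓘(ℝ, E) G) s) {F : Set V.horizontal}
    (hF : Submodule.span ℝ F = ⊤) {N : Set G} (hN : IsOpen N) (h1 : 1 ∈ N) :
    ∃ p ∈ N, p ∈ interior (horizontalMonoid F : Set G) := by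
  refine exists_mem_interior_controlMonoid (E := E) ?_ hN h1
  intro K hFK hK
  have hspan : V.layer 1 ≤ Submodule.span ℝ
      ((fun Y : V.horizontal => (Y : GroupLieAlgebra 𝓘(ℝ, E) G)) '' F) := by
    have h := Submodule.map_span V.horizontal.subtype F
    rw [hF, Submodule.map_top, Submodule.range_subtype] at h
    exact h.le
  exact V.eq_top_of_lie_mem (K := K) hspan hFK hK

end Semigroup

/-! ### The two claims. -/

theorem proposition3p7 {n s : ℕ} {G : Type*} [TopologicalSpace G] [T2Space G]
    [ChartedSpace (EuclideanSpace ℝ (Fin n)) G] [Group G] [LieGroup (𝓡 n) ∞ G]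
    [SimplyConnectedSpace G]
    (V : LieStratification (GroupLieAlgebra (𝓡 n) G) s)
    (B : LinearMap.BilinForm ℝ V.horizontal) (hB : IsScalarProduct B) :
    (∀ ν : bilinUnitSphere B, ∃ U : Set (bilinUnitSphere B), IsOpen U ∧ ν ∈ U ∧
      (interior (⋂ μ ∈ U, semigroupOfNormal B (μ : V.horizontal))).Nonempty) ∧
    (∀ (ν : bilinUnitSphere B) (X : V.horizontal),
      lieExp (X : GroupLieAlgebra (𝓡 n) G) ∈
        interior (semigroupOfNormal B (ν : V.horizontal)) →
      ∃ U : Set (bilinUnitSphere B), IsOpen U ∧ ν ∈ U ∧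
        lieExp (X : GroupLieAlgebra (𝓡 n) G) ∈
          interior (⋂ μ ∈ U, semigroupOfNormal B (μ : V.horizontal))) := by
  have : IsTopologicalGroup G := topologicalGroup_of_lieGroup (𝓡 n) ∞
  have : FiniteDimensional ℝ (GroupLieAlgebra (𝓡 n) G) :=
    inferInstanceAs (FiniteDimensional ℝ (EuclideanSpace ℝ (Fin n)))
  refine ⟨fun ν => ?_, fun ν X hX => ?_⟩
  · obtain ⟨F, hF, hpos, hspan⟩ := exists_finite_span_eq_top_of_pos ν.2
    obtain ⟨U, hU, hνU, hsub⟩ := subset_interior_iInter_semigroupOfNormal (ν := ν) hF hpos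
    obtain ⟨p, _, hp⟩ := exists_mem_interior_horizontalMonoid V hspan isOpen_univ (mem_univ 1)
    exact ⟨U, hU, hνU, p, hsub hp⟩
  · obtain ⟨F, hF, hpos, hspan⟩ := exists_finite_span_eq_top_of_pos ν.2
    set g := lieExp (X : GroupLieAlgebra (𝓡 n) G)
    have hN : IsOpen ((fun p => g * p⁻¹) ⁻¹'
        interior (semigroupOfNormal B (ν : V.horizontal))) :=
      isOpen_interior.preimage (continuous_const.mul continuous_inv)
    obtain ⟨p, hpN, hp⟩ := exists_mem_interior_horizontalMonoid V hspan hN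
      (by simpa only [mem_preimage, inv_one, mul_one] using hX)
    -- At `h = g * p⁻¹` the element `h⁻¹ * g` is `p`, an interior point, so nearby `h` work too.
    have hO : (fun h => h⁻¹ * g) ⁻¹' interior (horizontalMonoid F : Set G) ∈ 𝓝 (g * p⁻¹) := by
      refine (isOpen_interior.preimage (continuous_inv.mul continuous_const)).mem_nhds ?_
      change (g * p⁻¹)⁻¹ * g ∈ interior (horizontalMonoid F : Set G)
      rwa [mul_inv_rev, inv_inv, inv_mul_cancel_right]
    obtain ⟨F', hF', hpos', h, hhO, hh⟩ :=
      exists_horizontalMonoid_mem_of_mem_semigroupOfNormal ν.2 (interior_subset hpN) _ hO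
    obtain ⟨U, hU, hνU, hsub⟩ := subset_interior_iInter_semigroupOfNormal (ν := ν)
      (hF.union hF') (fun Y hY => hY.elim (hpos Y) (hpos' Y))
    refine ⟨U, hU, hνU, hsub ?_⟩
    -- The translate by `h` of the interior of the monoid of `F` is an open set containing `g`,
    -- inside the monoid of `F ∪ F'`.
    have hopen : IsOpen ((fun y => h⁻¹ * y) ⁻¹' interior (horizontalMonoid F : Set G)) :=
      isOpen_interior.preimage (continuous_const_mul h⁻¹)
    refine mem_interior.mpr ⟨_, fun y hy => ?_, hopen, hhO⟩
    have hy' := horizontalMonoid_mono (subset_union_left (t := F')) (interior_subset hy)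
    have hmul := mul_mem (horizontalMonoid_mono (subset_union_right (s := F)) hh) hy'
    rwa [mul_inv_cancel_left] at hmul
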